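/- There is an absolute constant $C>0$ such that the following holds. Let $1\le m\le n$ and $k\ge 0$ be integers, and let $\mathcal A=(A_1,\dots,A_k)$ with $A_i\in\mathbb R^{m\times n}$ for $1\le i\le k$. Write $s=s(\mathcal A):=\sum_{i=1}^k\|A_i\|_F^2$. Let $\epsilon\ge 0$ and $\lambda>0$ be real numbers such that: (1) ($\mathcal A$ is $\epsilon$-nearly doubly balanced) in the positive semidefinite order, \[ (1-\epsilon)\frac{s}{m}I_m\preceq\sum_{i=1}^kA_iA_i^*\preceq(1+\epsilon)\frac{s}{m}I_m \quad\text{and}\quad (1-\epsilon)\frac{s}{n}I_n\preceq\sum_{i=1}^kA_i^*A_i\preceq(1+\epsilon)\frac{s}{n}I_n; \] (2) ($\mathcal A$ has a $\lambda$-spectral gap) $\sigma_2(M_{\mathcal A})\le(1-\lambda)\dfrac{s}{\sqrt{mn}}$, where $\sigma_2(M_{\mathcal A})$ is the second largest singular value, counted with multiplicity and taken to be $0$ if there is none, of the $m^2\times n^2$ matrix $M_{\mathcal A}:=\sum_{i=1}^kA_i\otimes A_i$; (3) $\lambda^2\ge C\,\epsilon\log m$. Then the capacity \[ \operatorname{cap}(\mathcal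 A):=\inf_{X\succ0}\frac{m\,\det\big(\sum_{i=1}^kA_iXA_i^*\big)^{1/m}}{\det(X)^{1/n}}, \] where $X$ ranges over the real symmetric positive definite $n\times n$ matrices, satisfies \[ s(\mathcal A)\ \ge\ \operatorname{cap}(\mathcal A)\ \ge\ \Big(1-\frac{4\epsilon^2}{\lambda}\Big)s(\mathcal A). \] -/

import Mathlib

open scoped Matrix Kronecker

namespace OperatorScaling

/-- An operator is a tuple `(A₁, …, A_k)` of real `m × n` matrices. -/
abbrev Operator (k m n : ℕ) : Type := Fin k → Matrix (Fin m) (Fin n) ℝ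

variable {k m n : ℕ}

/-- The completely positive map `Φ(Y) = ∑ᵢ Aᵢ Y Aᵢ*`. -/
def cpMap (A : Operator k m n) (Y : Matrix (Fin n) (Fin n) ℝ) : Matrix (Fin m) (Fin m) ℝ :=
  ∑ i, A i * Y * (A i)ᵀ

/-- The adjoint map `Φ*(X) = ∑ᵢ Aᵢ* X Aᵢ`. -/
def cpMapAdjoint (A : Operator k m n) (X : Matrix (Fin m) (Fin m) ℝ) :
    Matrix (Fin n) (Fin n) ℝ :=
  ∑ i, (A i)ᵀ * X * A i

/-- The size `s(A)`: the sum of the squared Frobenius norms of the matrices `Aᵢ`. -/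
def size (A : Operator k m n) : ℝ := ∑ i, ∑ a, ∑ b, A i a b ^ 2

/-- `A` is `ε`-nearly doubly balanced: in the Loewner order,
`(1 - ε) (s/m) I ≤ Φ(I) ≤ (1 + ε) (s/m) I` and `(1 - ε) (s/n) I ≤ Φ*(I) ≤ (1 + ε) (s/n) I`. -/
structure IsNearlyDoublyBalanced (A : Operator k m n) (ε : ℝ) : Prop where
  left_lower : (cpMap A 1 - ((1 - ε) * (size A / m)) • 1).PosSemidef
  left_upper : (((1 + ε) * (size A / m)) • 1 - cpMap A 1).PosSemidef
  right_lower : (cpMapAdjoint A 1 - ((1 - ε) * (size A / n)) • 1).PosSemidef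
  right_upper : (((1 + ε) * (size A / n)) • 1 - cpMapAdjoint A 1).PosSemidef

/-- The `m² × n²` matrix `M_A = ∑ᵢ Aᵢ ⊗ Aᵢ`. -/
def matrixRep (A : Operator k m n) : Matrix (Fin m × Fin m) (Fin n × Fin n) ℝ :=
  ∑ i, A i ⊗ₖ A i

/-- The second largest singular value of a real matrix, counted with multiplicity (the sequence
`LinearMap.singularValues` is non-increasing and starts at index `0`). It is `0` for a matrix
of rank at most one. -/
noncomputable def sigmaTwo {p q : Type*} [Fintype p] [DecidableEq p] [Fintype q] [DecidableEq q]
    (M : Matrix p q ℝ) : ℝ :=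
  (Matrix.toEuclideanLin M).singularValues 1

/-- `A` has a `lam`-spectral gap: `σ₂(M_A) ≤ (1 - lam) s(A) / √(mn)`. -/
def HasSpectralGap (A : Operator k m n) (lam : ℝ) : Prop :=
  sigmaTwo (matrixRep A) ≤ (1 - lam) * (size A / √((m : ℝ) * n))

/-- The capacity of `A`: the infimum over positive definite `X` of
`m det(Φ(X))^(1/m) / det(X)^(1/n)`. -/
noncomputable def capacity (A : Operator k m n) : ℝ :=
  ⨅ X : {X : Matrix (Fin n) (Fin n) ℝ // X.PosDef},
    m * (cpMap A X.1).det ^ (1 / (m : ℝ)) / X.1.det ^ (1 / (n : ℝ))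

/-- The set whose infimum is the capacity is bounded below (and it is visibly nonempty), so that
the capacity is a genuine infimum. -/
theorem capacity_bddBelow (A : Operator k m n) :
    BddBelow (Set.range fun X : {X : Matrix (Fin n) (Fin n) ℝ // X.PosDef} =>
      m * (cpMap A X.1).det ^ (1 / (m : ℝ)) / X.1.det ^ (1 / (n : ℝ))) := by
  refine ⟨0, ?_⟩
  rintro _ ⟨X, rfl⟩
  have h1 : (cpMap A X.1).PosSemidef := by
    unfold cpMap
    refine Matrix.posSemidef_sum _ fun i _ => ?_
    have := X.2.posSemidef.mul_mul_conjTranspose_same (A i)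
    rwa [Matrix.conjTranspose_eq_transpose_of_trivial] at this
  have h2 := h1.det_nonneg
  have h3 := X.2.det_pos
  dsimp only
  positivity

end OperatorScaling

set_option linter.unusedSectionVars false

/-! The upper bound is AM-GM at `X = I`, since `tr Φ(I) = s`. For the lower bound, put `Φ = (m/s) ∑
Aᵢ · Aᵢᵀ` and `Ψ = (n/s) ∑ Aᵢᵀ · Aᵢ`. These are adjoint for the normalized traces and send `I` into
`[1 - ε, 1 + ε]`.

Suppose `Y₀` is a fixed point of the operator Sinkhorn map `Y ↦ (Φ((Ψ Y)⁻¹))⁻¹`, and let `X₀ = (Ψ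
Y₀)⁻¹`. Then Jensen's inequality for `log` shows that `X₀` minimizes the capacity functional
(`log_det_div_le_of_fixed_point`), so `cap ≥ s exp(-ψ)` with `ψ = log det Y₀ / m + log det X₀ / n`.
It remains to find such a point near `I` and to bound `ψ`.

Existence (`sinkhorn_bounds`, `exists_fixed_point`): in operator norm one round costs at most a
factor `(1 + ε)/(1 - ε)`, while in normalized Frobenius norm the gap makes increments shrink by `1 -
λ/2`. Going from Frobenius to operator norm loses `√m`, which is absorbed after about `log m / λ`
rounds. The iterates have by then drifted by `O(ε log m / λ)`, and hypothesis (3) makes this a small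
multiple of `λ`.

Value (`log_det_add_log_det_le`): expand both log-determinants to second order around `I`. The
constraint `tip Y (Φ X) = 1` bounds the first-order term by terms linear in `ε` and a cross term
with coefficient `1 - 9λ/10`. The negative squares beat the cross term by a multiple of `λ`, and
completing squares leaves `ψ ≤ 2ε²/λ`.

For `m = 1` hypothesis (3) says nothing about `ε`, but the fixed point is explicit
(`le_capacity_of_one`). -/

namespace OperatorScaling

open scoped MatrixOrder

/-! ### Loewner-order inequalities for squares and inverses. -/

section MatrixBounds

variable {ι : Type*} [Fintype ι] [DecidableEq ι]

theorem smul_one_le_smul_one {a b : ℝ} (h : a ≤ b) :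
    a • (1 : Matrix ι ι ℝ) ≤ b • 1 := by
  rw [Matrix.le_iff, ← sub_smul]
  exact Matrix.PosSemidef.one.smul (sub_nonneg.2 h)

theorem smul_le_smul_of_posSemidef {c : ℝ} (hc : 0 ≤ c) {P Q : Matrix ι ι ℝ} (h : P ≤ Q) :
    c • P ≤ c • Q := by
  rw [Matrix.le_iff] at h ⊢
  rw [← smul_sub]
  exact h.smul hc

theorem posDef_of_smul_one_le {a : ℝ} (ha : 0 < a) {P : Matrix ι ι ℝ} (h : a • 1 ≤ P) :
    P.PosDef := by
  have : P = a • 1 + (P - a • 1) := by abel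
  rw [this]
  exact (Matrix.PosDef.one.smul ha).add_posSemidef h

theorem posSemidef_mul_mul_symm {P Q : Matrix ι ι ℝ} (hP : P.PosSemidef) (hQ : Q.IsHermitian) :
    (Q * P * Q).PosSemidef := by
  have := hP.mul_mul_conjTranspose_same Q
  rwa [hQ.eq] at this

/-- The identity `b (bP - P²) = (b - P) P (b - P) + P (b - P) P` exhibits positivity without
spectral calculus. -/
theorem mul_self_le_smul {b : ℝ} {P : Matrix ι ι ℝ} (h0 : 0 ≤ P) (h : P ≤ b • 1) (hb : 0 < b) :
    P * P ≤ b • P := by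
  have h0' : P.PosSemidef := Matrix.nonneg_iff_posSemidef.1 h0
  have h' : (b • 1 - P).PosSemidef := h
  have e : b • P - P * P = b⁻¹ • ((b • 1 - P) * P * (b • 1 - P) + P * (b • 1 - P) * P) := by
    have : b⁻¹ • (b • (b • P - P * P)) = b • P - P * P := by
      rw [smul_smul, inv_mul_cancel₀ hb.ne', one_smul]
    rw [← this]
    congr 1
    simp only [sub_mul, mul_sub, smul_mul_assoc, mul_smul_comm, one_mul, mul_one, smul_sub,
      mul_assoc, smul_smul]
    abel
  rw [Matrix.le_iff, e]
  exact ((posSemidef_mul_mul_symm h0' h'.1).add (posSemidef_mul_mul_symm h' h0'.1)).smul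
    (inv_nonneg.2 hb.le)

theorem inv_le_of_smul_one_le {a : ℝ} (ha : 0 < a) {P : Matrix ι ι ℝ} (h : a • 1 ≤ P) :
    P⁻¹ ≤ a⁻¹ • 1 := by
  have hP := posDef_of_smul_one_le ha h
  have hu : IsUnit P.det := hP.det_pos.ne'.isUnit
  have h' : (P - a • 1).PosSemidef := h
  have e : a⁻¹ • 1 - P⁻¹ =
      a⁻¹ • (P⁻¹ * ((P - a • 1) * 1 * (P - a • 1) + a • (P - a • 1)) * P⁻¹) := by
    have : (P - a • 1) * 1 * (P - a • 1) + a • (P - a • 1) = P * P - a • P := by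
      simp only [sub_mul, mul_sub, smul_mul_assoc, mul_smul_comm, one_mul, mul_one, smul_sub,
        smul_smul]
      abel
    rw [this, mul_sub, sub_mul, ← mul_assoc, Matrix.nonsing_inv_mul _ hu, one_mul,
      Matrix.mul_nonsing_inv _ hu, mul_smul_comm, smul_mul_assoc, Matrix.nonsing_inv_mul _ hu,
      one_mul, smul_sub, smul_smul, inv_mul_cancel₀ ha.ne', one_smul]
  rw [Matrix.le_iff, e]
  exact (posSemidef_mul_mul_symm ((posSemidef_mul_mul_symm Matrix.PosSemidef.one h'.1).add
    (h'.smul ha.le)) hP.inv.isHermitian).smul (inv_nonneg.2 ha.le)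

theorem smul_one_le_inv {b : ℝ} {P : Matrix ι ι ℝ} (hP : P.PosDef) (hb : 0 < b)
    (h : P ≤ b • 1) : b⁻¹ • 1 ≤ P⁻¹ := by
  have hu : IsUnit P.det := hP.det_pos.ne'.isUnit
  have h' : (b • P - P * P).PosSemidef :=
    mul_self_le_smul (Matrix.nonneg_iff_posSemidef.2 hP.posSemidef) h hb
  have e : P⁻¹ - b⁻¹ • 1 = b⁻¹ • (P⁻¹ * (b • P - P * P) * P⁻¹) := by
    rw [mul_sub, sub_mul, ← mul_assoc, Matrix.nonsing_inv_mul _ hu, one_mul,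
      Matrix.mul_nonsing_inv _ hu, mul_smul_comm, smul_mul_assoc, Matrix.nonsing_inv_mul _ hu,
      one_mul, smul_sub, smul_smul, inv_mul_cancel₀ hb.ne', one_smul]
  rw [Matrix.le_iff, e]
  exact (posSemidef_mul_mul_symm h' hP.inv.isHermitian).smul (inv_nonneg.2 hb.le)

theorem trace_le_trace {P Q : Matrix ι ι ℝ} (h : P ≤ Q) : P.trace ≤ Q.trace := by
  have := Matrix.PosSemidef.trace_nonneg (Matrix.le_iff.1 h)
  rw [Matrix.trace_sub] at this
  linarith

/-- Apply `mul_self_le_smul` to `U + c` with bound `2c`; this needs `c > 0`, hence the separate case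
`c = 0`. -/
theorem mul_self_le {c : ℝ} (hcd : 0 ≤ c) {U : Matrix ι ι ℝ} (h1 : (-c) • 1 ≤ U)
    (h2 : U ≤ c • 1) : U * U ≤ (c ^ 2) • 1 := by
  have a1 : (U + c • 1).PosSemidef := by
    have := Matrix.le_iff.1 h1
    rwa [neg_smul, sub_neg_eq_add] at this
  rcases hcd.eq_or_lt with rfl | hc
  · have : U = 0 := le_antisymm (by simpa using h2) (by simpa using h1)
    simp [this]
  have a2 := mul_self_le_smul (b := 2 * c) (Matrix.nonneg_iff_posSemidef.2 a1)
    (by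
      rw [two_mul, add_smul]
      exact add_le_add_left h2 _) (by positivity)
  rw [Matrix.le_iff] at a2 ⊢
  convert a2 using 1
  simp only [add_mul, mul_add, smul_mul_assoc, mul_smul_comm, one_mul, mul_one, smul_add,
    smul_smul, two_mul, add_smul, sq]
  abel

end MatrixBounds

/-! ### Normalized trace inner product and its norm. -/

section NormalizedTrace

variable {ι : Type*} [Fintype ι]

/-- The normalized trace inner product `tr(Aᵀ B) / |ι|`. -/
noncomputable def tip (A B : Matrix ι ι ℝ) : ℝ := (Aᵀ * B).trace / Fintype.card ι

/-- The normalized Frobenius norm. -/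
noncomputable def rms (A : Matrix ι ι ℝ) : ℝ := √(tip A A)

theorem tip_eq_sum (A B : Matrix ι ι ℝ) :
    tip A B = (∑ p : ι × ι, A p.1 p.2 * B p.1 p.2) / Fintype.card ι := by
  unfold tip
  congr 1
  rw [Fintype.sum_prod_type_right]
  simp [Matrix.trace, Matrix.mul_apply]

theorem tip_comm (A B : Matrix ι ι ℝ) : tip A B = tip B A := by
  simp only [tip_eq_sum, mul_comm]

theorem tip_add_left (A B C : Matrix ι ι ℝ) : tip (A + B) C = tip A C + tip B C := by
  simp [tip, add_mul, add_div]

theorem tip_add_right (A B C : Matrix ι ι ℝ) : tip A (B + C) = tip A B + tip A C := by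
  simp [tip, mul_add, add_div]

theorem tip_sub_left (A B C : Matrix ι ι ℝ) : tip (A - B) C = tip A C - tip B C := by
  simp [tip, sub_mul, sub_div]

theorem tip_sub_right (A B C : Matrix ι ι ℝ) : tip A (B - C) = tip A B - tip A C := by
  simp [tip, mul_sub, sub_div]

theorem tip_smul_left (c : ℝ) (A B : Matrix ι ι ℝ) : tip (c • A) B = c * tip A B := by
  simp [tip, mul_div_assoc]

theorem tip_smul_right (c : ℝ) (A B : Matrix ι ι ℝ) : tip A (c • B) = c * tip A B := by
  simp [tip, mul_div_assoc]

theorem tip_self_nonneg (A : Matrix ι ι ℝ) : 0 ≤ tip A A := by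
  rw [tip_eq_sum]
  exact div_nonneg (Finset.sum_nonneg fun _ _ => mul_self_nonneg _) (Nat.cast_nonneg _)

theorem rms_nonneg (A : Matrix ι ι ℝ) : 0 ≤ rms A := Real.sqrt_nonneg _

theorem rms_sq (A : Matrix ι ι ℝ) : rms A ^ 2 = tip A A := Real.sq_sqrt (tip_self_nonneg A)

theorem abs_tip_le (A B : Matrix ι ι ℝ) : |tip A B| ≤ rms A * rms B := by
  rw [← abs_of_nonneg (mul_nonneg (rms_nonneg A) (rms_nonneg B)), ← sq_le_sq, mul_pow, rms_sq,
    rms_sq, tip_eq_sum, tip_eq_sum, tip_eq_sum, div_pow, div_mul_div_comm, ← sq]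
  refine div_le_div_of_nonneg_right ?_ (sq_nonneg _)
  simpa [sq] using Finset.sum_mul_sq_le_sq_mul_sq Finset.univ
    (fun p : ι × ι => A p.1 p.2) (fun p => B p.1 p.2)

theorem tip_le (A B : Matrix ι ι ℝ) : tip A B ≤ rms A * rms B :=
  (le_abs_self _).trans (abs_tip_le A B)

theorem rms_add_le (A B : Matrix ι ι ℝ) : rms (A + B) ≤ rms A + rms B := by
  refine abs_le_of_sq_le_sq' ?_ (add_nonneg (rms_nonneg A) (rms_nonneg B)) |>.2
  rw [rms_sq, tip_add_left, tip_add_right, tip_add_right, add_sq, rms_sq, rms_sq, tip_comm B A]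
  linarith [tip_le A B]

theorem rms_smul (c : ℝ) (A : Matrix ι ι ℝ) : rms (c • A) = |c| * rms A := by
  unfold rms
  rw [tip_smul_left, tip_smul_right, ← mul_assoc, Real.sqrt_mul (mul_self_nonneg c),
    Real.sqrt_mul_self_eq_abs]

theorem rms_neg (A : Matrix ι ι ℝ) : rms (-A) = rms A := by
  simpa using rms_smul (-1) A

theorem rms_transpose (A : Matrix ι ι ℝ) : rms Aᵀ = rms A := by
  unfold rms tip
  rw [Matrix.transpose_transpose, Matrix.trace_mul_comm]

theorem abs_apply_le (A : Matrix ι ι ℝ) (i j : ι) : |A i j| ≤ √(Fintype.card ι) * rms A := by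
  have : Nonempty ι := ⟨i⟩
  have hc : (0 : ℝ) < Fintype.card ι := by exact_mod_cast Fintype.card_pos
  unfold rms
  rw [← Real.sqrt_mul hc.le, tip_eq_sum, mul_div_cancel₀ _ hc.ne']
  refine Real.abs_le_sqrt ?_
  rw [sq]
  exact Finset.single_le_sum (f := fun p : ι × ι => A p.1 p.2 * A p.1 p.2)
    (fun _ _ => mul_self_nonneg _) (Finset.mem_univ (i, j))

/-- The operator norm is at most the Frobenius norm, which is `√|ι|` times `rms`. This factor is the
source of `log m` in the main hypothesis. -/
theorem le_rms_smul_one [DecidableEq ι] {A : Matrix ι ι ℝ} (hA : A.IsHermitian) {c : ℝ}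
    (hc : √(Fintype.card ι) * rms A ≤ c) : A ≤ c • 1 := by
  have h0 : 0 ≤ c := (mul_nonneg (Real.sqrt_nonneg _) (rms_nonneg A)).trans hc
  refine Matrix.PosSemidef.of_dotProduct_mulVec_nonneg
    (((Matrix.PosSemidef.one.smul h0).1).sub hA) fun x => ?_
  have hx : 0 ≤ ∑ i, x i ^ 2 := Finset.sum_nonneg fun _ _ => sq_nonneg _
  have h0 : 0 ≤ c := (mul_nonneg (Real.sqrt_nonneg _) (rms_nonneg A)).trans hc
  have e1 : star x ⬝ᵥ ((c • (1 : Matrix ι ι ℝ) - A) *ᵥ x) =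
      c * ∑ i, x i ^ 2 - ∑ p : ι × ι, A p.1 p.2 * (x p.1 * x p.2) := by
    rw [Matrix.sub_mulVec, dotProduct_sub, Matrix.smul_mulVec, Matrix.one_mulVec,
      dotProduct_smul, Fintype.sum_prod_type]
    simp [dotProduct, Matrix.mulVec, Finset.mul_sum, sq]
    exact Finset.sum_congr rfl fun i _ => Finset.sum_congr rfl fun j _ => by ring
  rw [e1, sub_nonneg]
  have e2 : (∑ p : ι × ι, A p.1 p.2 * (x p.1 * x p.2)) ^ 2 ≤
      (∑ p : ι × ι, A p.1 p.2 ^ 2) * ∑ p : ι × ι, (x p.1 * x p.2) ^ 2 :=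
    Finset.sum_mul_sq_le_sq_mul_sq _ _ _
  have e3 : ∑ p : ι × ι, (x p.1 * x p.2) ^ 2 = (∑ i, x i ^ 2) ^ 2 := by
    rw [sq (∑ i, x i ^ 2), Finset.sum_mul_sum, Fintype.sum_prod_type]
    simp [mul_pow]
  have e4 : ∑ p : ι × ι, A p.1 p.2 ^ 2 ≤ c ^ 2 := by
    rcases isEmpty_or_nonempty ι with h | h
    · simpa using sq_nonneg c
    have hcard : (0 : ℝ) < Fintype.card ι := by exact_mod_cast Fintype.card_pos
    have := pow_le_pow_left₀ (mul_nonneg (Real.sqrt_nonneg _) (rms_nonneg A)) hc 2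
    rw [mul_pow, Real.sq_sqrt hcard.le, rms_sq, tip_eq_sum, mul_div_cancel₀ _ hcard.ne'] at this
    simpa [sq] using this
  refine abs_le_of_sq_le_sq' ?_ (mul_nonneg h0 hx) |>.2
  rw [mul_pow]
  rw [e3] at e2
  exact e2.trans (mul_le_mul_of_nonneg_right e4 (sq_nonneg _))

theorem neg_rms_smul_one_le [DecidableEq ι] {A : Matrix ι ι ℝ} (hA : A.IsHermitian) {c : ℝ}
    (hc : √(Fintype.card ι) * rms A ≤ c) : (-c) • 1 ≤ A := by
  have := le_rms_smul_one hA.neg (c := c) (by rwa [rms_neg])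
  rw [neg_smul]
  exact neg_le.1 this

variable [DecidableEq ι]

theorem rms_one [Nonempty ι] : rms (1 : Matrix ι ι ℝ) = 1 := by
  simp [rms, tip]

theorem rms_mul_left_le {b : ℝ} (hb : 0 < b) {P : Matrix ι ι ℝ} (h0 : 0 ≤ P) (h : P ≤ b • 1)
    (D : Matrix ι ι ℝ) : rms (P * D) ≤ b * rms D := by
  have hP : P.PosSemidef := Matrix.nonneg_iff_posSemidef.1 h0
  have h2 : P * P ≤ (b ^ 2) • 1 := by
    refine (mul_self_le_smul h0 h hb).trans ?_
    rw [sq, ← smul_smul]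
    exact smul_le_smul_of_posSemidef hb.le h
  refine abs_le_of_sq_le_sq' ?_ (mul_nonneg hb.le (rms_nonneg D)) |>.2
  rw [mul_pow, rms_sq, rms_sq]
  unfold tip
  rw [mul_div_assoc']
  refine div_le_div_of_nonneg_right ?_ (Nat.cast_nonneg _)
  have h3 := (Matrix.le_iff.1 h2).conjTranspose_mul_mul_same D |>.trace_nonneg
  have e : Pᵀ = P := by simpa using hP.1.eq
  rw [Matrix.transpose_mul, e]
  simp only [Matrix.conjTranspose_eq_transpose_of_trivial, mul_sub, sub_mul, Matrix.trace_sub,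
    mul_smul_comm, smul_mul_assoc, mul_one, Matrix.trace_smul, smul_eq_mul] at h3
  simp only [mul_assoc] at h3 ⊢
  linarith

theorem rms_mul_right_le {b : ℝ} (hb : 0 < b) {P : Matrix ι ι ℝ} (h0 : 0 ≤ P) (h : P ≤ b • 1)
    (D : Matrix ι ι ℝ) : rms (D * P) ≤ b * rms D := by
  have hP : P.PosSemidef := Matrix.nonneg_iff_posSemidef.1 h0
  have e : Pᵀ = P := by simpa using hP.1.eq
  rw [← rms_transpose, Matrix.transpose_mul, e, ← rms_transpose D]
  exact rms_mul_left_le hb h0 h _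

theorem rms_le_of_le {c : ℝ} (hc : 0 ≤ c) {U : Matrix ι ι ℝ} (hU : U.IsHermitian)
    (h1 : (-c) • 1 ≤ U) (h2 : U ≤ c • 1) : rms U ≤ c := by
  refine abs_le_of_sq_le_sq' ?_ hc |>.2
  rw [rms_sq]
  have e : Uᵀ = U := by simpa using hU.eq
  unfold tip
  rcases isEmpty_or_nonempty ι with h | h
  · simpa using sq_nonneg c
  have hcard : (0 : ℝ) < Fintype.card ι := by exact_mod_cast Fintype.card_pos
  rw [e, div_le_iff₀ hcard]
  simpa using trace_le_trace (mul_self_le hc h1 h2)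

end NormalizedTrace

/-! ### Log-determinants through eigenvalues. -/

section LogDet

variable {ι : Type*} [Fintype ι] [DecidableEq ι]

theorem exists_orthogonal_conj_eq_diagonal {P : Matrix ι ι ℝ} (hP : P.IsHermitian) :
    ∃ U : Matrix ι ι ℝ, Uᵀ * U = 1 ∧ U * Uᵀ = 1 ∧
      P = U * Matrix.diagonal hP.eigenvalues * Uᵀ := by
  refine ⟨hP.eigenvectorUnitary, ?_, ?_, ?_⟩
  · simpa [Matrix.star_eq_conjTranspose] using Unitary.coe_star_mul_self hP.eigenvectorUnitary
  · simpa [Matrix.star_eq_conjTranspose] using Unitary.coe_mul_star_self hP.eigenvectorUnitary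
  · have := hP.spectral_theorem
    rw [Unitary.conjStarAlgAut_apply] at this
    simpa [Matrix.star_eq_conjTranspose, Function.comp_def] using this

theorem eigenvalues_le_of_le {b : ℝ} {P : Matrix ι ι ℝ} (hP : P.IsHermitian) (h : P ≤ b • 1)
    (i : ι) : hP.eigenvalues i ≤ b := by
  obtain ⟨U, h1, h2, h3⟩ := exists_orthogonal_conj_eq_diagonal hP
  have h4 := (Matrix.le_iff.1 h).conjTranspose_mul_mul_same U
  have e : Uᴴ * (b • 1 - P) * U = Matrix.diagonal (fun i => b - hP.eigenvalues i) := by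
    rw [Matrix.conjTranspose_eq_transpose_of_trivial, mul_sub, sub_mul]
    conv_lhs => rw [h3]
    have : Uᵀ * (U * Matrix.diagonal hP.eigenvalues * Uᵀ) * U =
        (Uᵀ * U) * Matrix.diagonal hP.eigenvalues * (Uᵀ * U) := by simp only [mul_assoc]
    rw [this, h1, mul_smul_comm, smul_mul_assoc, mul_one, h1, one_mul, mul_one]
    ext i j
    by_cases hij : i = j
    · subst hij; simp
    · simp [hij]
  rw [e, Matrix.posSemidef_diagonal_iff] at h4
  linarith [h4 i]

theorem le_eigenvalues_of_le {b : ℝ} {P : Matrix ι ι ℝ} (hP : P.IsHermitian) (h : b • 1 ≤ P)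
    (i : ι) : b ≤ hP.eigenvalues i := by
  obtain ⟨U, h1, h2, h3⟩ := exists_orthogonal_conj_eq_diagonal hP
  have h4 := (Matrix.le_iff.1 h).conjTranspose_mul_mul_same U
  have e : Uᴴ * (P - b • 1) * U = Matrix.diagonal (fun i => hP.eigenvalues i - b) := by
    rw [Matrix.conjTranspose_eq_transpose_of_trivial, mul_sub, sub_mul]
    conv_lhs => rw [h3]
    have : Uᵀ * (U * Matrix.diagonal hP.eigenvalues * Uᵀ) * U =
        (Uᵀ * U) * Matrix.diagonal hP.eigenvalues * (Uᵀ * U) := by simp only [mul_assoc]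
    rw [this, h1, mul_smul_comm, smul_mul_assoc, mul_one, mul_one, h1, one_mul]
    ext i j
    by_cases hij : i = j
    · subst hij; simp
    · simp [hij]
  rw [e, Matrix.posSemidef_diagonal_iff] at h4
  linarith [h4 i]

theorem trace_sub_one_eq_sum {P : Matrix ι ι ℝ} (hP : P.IsHermitian) :
    (P - 1).trace = ∑ i, (hP.eigenvalues i - 1) := by
  rw [Matrix.trace_sub, hP.trace_eq_sum_eigenvalues]
  simp

theorem trace_sub_one_mul_self {P : Matrix ι ι ℝ} (hP : P.IsHermitian) :
    ((P - 1) * (P - 1)).trace = ∑ i, (hP.eigenvalues i - 1) ^ 2 := by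
  obtain ⟨U, h1, h2, h3⟩ := exists_orthogonal_conj_eq_diagonal hP
  have e : P - 1 = U * Matrix.diagonal (fun i => hP.eigenvalues i - 1) * Uᵀ := by
    have : Matrix.diagonal (fun i => hP.eigenvalues i - 1) =
        Matrix.diagonal hP.eigenvalues - 1 := by
      rw [← Matrix.diagonal_one, Matrix.diagonal_sub]
    rw [this, mul_sub, sub_mul, ← h3, mul_one, h2]
  rw [e]
  have : (U * Matrix.diagonal (fun i => hP.eigenvalues i - 1) * Uᵀ) *
      (U * Matrix.diagonal (fun i => hP.eigenvalues i - 1) * Uᵀ) =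
      U * Matrix.diagonal (fun i => hP.eigenvalues i - 1) * (Uᵀ * U) *
      Matrix.diagonal (fun i => hP.eigenvalues i - 1) * Uᵀ := by simp only [mul_assoc]
  rw [this, h1, mul_one, Matrix.trace_mul_comm, ← mul_assoc, ← mul_assoc, h1, one_mul,
    Matrix.diagonal_mul_diagonal, Matrix.trace_diagonal]
  simp [sq]

theorem log_det_eq_sum {P : Matrix ι ι ℝ} (hP : P.PosDef) :
    Real.log P.det = ∑ i, Real.log (hP.1.eigenvalues i) := by
  rw [hP.1.det_eq_prod_eigenvalues]
  exact Real.log_prod fun i _ => (hP.eigenvalues_pos i).ne'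

theorem log_det_le {P : Matrix ι ι ℝ} (hP : P.PosDef) {η : ℝ}
    (h : ∀ i, Real.log (hP.1.eigenvalues i) ≤
      (hP.1.eigenvalues i - 1) - η * (hP.1.eigenvalues i - 1) ^ 2) :
    Real.log P.det ≤ (P - 1).trace - η * ((P - 1) * (P - 1)).trace := by
  rw [log_det_eq_sum hP, trace_sub_one_eq_sum hP.1, trace_sub_one_mul_self hP.1, Finset.mul_sum,
    ← Finset.sum_sub_distrib]
  exact Finset.sum_le_sum fun i _ => h i

theorem le_log_det {P : Matrix ι ι ℝ} (hP : P.PosDef) {η : ℝ}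
    (h : ∀ i, (hP.1.eigenvalues i - 1) - η * (hP.1.eigenvalues i - 1) ^ 2 ≤
      Real.log (hP.1.eigenvalues i)) :
    (P - 1).trace - η * ((P - 1) * (P - 1)).trace ≤ Real.log P.det := by
  rw [log_det_eq_sum hP, trace_sub_one_eq_sum hP.1, trace_sub_one_mul_self hP.1, Finset.mul_sum,
    ← Finset.sum_sub_distrib]
  exact Finset.sum_le_sum fun i _ => h i

theorem det_rpow_le_trace_div [Nonempty ι] {P : Matrix ι ι ℝ} (hP : P.PosSemidef) :
    P.det ^ (1 / (Fintype.card ι : ℝ)) ≤ P.trace / Fintype.card ι := by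
  have := Real.geom_mean_le_arith_mean Finset.univ (fun _ : ι => (1 : ℝ)) hP.1.eigenvalues
    (fun _ _ => zero_le_one) (by simp [Fintype.card_pos]) (fun i _ => hP.eigenvalues_nonneg i)
  rw [hP.1.det_eq_prod_eigenvalues, hP.1.trace_eq_sum_eigenvalues]
  simpa using this

end LogDet

/-- As `N ≥ 1`, `hq` is a quadratic inequality in `t` with leading coefficient at least `ν = 1 - (1
- lam)²`. It has a real solution only if `ν (g² - (1 - lam)² d²) ≤ c²`; since `c = O(ε d)` and `ν ≥
lam`, `g` barely exceeds `(1 - lam) d`. -/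
theorem le_of_quadratic_le {lam ε d g c t N : ℝ} (hlam : 0 < lam) (hlam1 : lam ≤ 1)
    (hd : 0 ≤ d) (hεl : ε ≤ lam / 100) (hc : |c| ≤ 3 * ε * d)
    (hN : 1 ≤ N) (hq : g ^ 2 + 2 * t * c + t ^ 2 * N ^ 2 ≤ (1 - lam) ^ 2 * (d ^ 2 + t ^ 2))
    (hgd : g ≤ (1 + ε) * d) : g ≤ (1 - 9 / 10 * lam) * d := by
  rcases hd.eq_or_lt with rfl | hd'
  · simpa using hgd
  have hc2 : c ^ 2 ≤ (9 / 10000) * lam ^ 2 * d ^ 2 := by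
    have i0 : 3 * ε * d ≤ 3 / 100 * lam * d := mul_le_mul_of_nonneg_right (by linarith) hd
    have i1 : |c| ^ 2 ≤ (3 / 100 * lam * d) ^ 2 :=
      pow_le_pow_left₀ (abs_nonneg _) (hc.trans i0) 2
    rw [sq_abs] at i1
    linarith [i1, show (3 / 100 * lam * d) ^ 2 = (9 / 10000) * lam ^ 2 * d ^ 2 by ring]
  have hN2 : t ^ 2 * 1 ≤ t ^ 2 * N ^ 2 :=
    mul_le_mul_of_nonneg_left (one_le_pow₀ hN) (sq_nonneg t)
  set ν := 1 - (1 - lam) ^ 2 with hν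
  have hs : lam ≤ ν := by nlinarith
  have hq' : t ^ 2 * ν + 2 * t * c + (g ^ 2 - (1 - lam) ^ 2 * d ^ 2) ≤ 0 := by
    rw [hν]
    linarith
  have hkey : ν * (g ^ 2 - (1 - lam) ^ 2 * d ^ 2) ≤ c ^ 2 := by
    have h1 := mul_le_mul_of_nonneg_left hq' (by linarith : 0 ≤ ν)
    have h2 := sq_nonneg (t * ν + c)
    linarith [show (t * ν + c) ^ 2 = ν * (t ^ 2 * ν + 2 * t * c) + c ^ 2 by ring]
  refine abs_le_of_sq_le_sq' ?_ (mul_nonneg (by linarith) hd) |>.2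
  by_contra! hcon
  rw [mul_pow] at hcon
  have h1 : 1 / 100 * lam * d ^ 2 ≤ g ^ 2 - (1 - lam) ^ 2 * d ^ 2 := by
    have h0 : 1 / 100 * lam + (1 - lam) ^ 2 ≤ (1 - 9 / 10 * lam) ^ 2 := by nlinarith
    have := mul_le_mul_of_nonneg_right h0 (sq_nonneg d)
    linarith
  have h2 : lam * (1 / 100 * lam * d ^ 2) ≤ c ^ 2 :=
    (mul_le_mul hs h1 (by positivity) (by linarith)).trans hkey
  have h3 : 0 < lam ^ 2 * d ^ 2 := by positivity
  linarith [show lam * (1 / 100 * lam * d ^ 2) = 1 / 100 * (lam ^ 2 * d ^ 2) by ring]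

/-! ### Balanced pairs of positive maps and their spectral gap. -/

section BalancedPair

variable {ι κ : Type*} [Fintype ι] [Fintype κ] [DecidableEq ι] [DecidableEq κ]

/-- A pair of positive maps, adjoint for the normalized trace inner products, both of which map
the identity into `[1 - ε, 1 + ε]`. -/
structure IsBalancedPair (Φ : Matrix κ κ ℝ →ₗ[ℝ] Matrix ι ι ℝ)
    (Ψ : Matrix ι ι ℝ →ₗ[ℝ] Matrix κ κ ℝ) (ε : ℝ) : Prop where
  map_nonneg : ∀ X, 0 ≤ X → 0 ≤ Φ X
  map_nonneg' : ∀ Y, 0 ≤ Y → 0 ≤ Ψ Y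
  tip_map : ∀ Y X, tip Y (Φ X) = tip (Ψ Y) X
  le_map_one : (1 - ε) • 1 ≤ Φ 1
  map_one_le : Φ 1 ≤ (1 + ε) • 1
  le_map_one' : (1 - ε) • 1 ≤ Ψ 1
  map_one_le' : Ψ 1 ≤ (1 + ε) • 1
  tip_one : tip 1 (Φ 1) = 1
  rms_map_le : ∀ X, rms (Φ X) ≤ (1 + ε) * rms X
  rms_map_le' : ∀ Y, rms (Ψ Y) ≤ (1 + ε) * rms Y

variable {Φ : Matrix κ κ ℝ →ₗ[ℝ] Matrix ι ι ℝ} {Ψ : Matrix ι ι ℝ →ₗ[ℝ] Matrix κ κ ℝ} {ε : ℝ}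

namespace IsBalancedPair

theorem symm (h : IsBalancedPair Φ Ψ ε) : IsBalancedPair Ψ Φ ε where
  map_nonneg := h.map_nonneg'
  map_nonneg' := h.map_nonneg
  tip_map X Y := by rw [tip_comm, ← h.tip_map, tip_comm]
  le_map_one := h.le_map_one'
  map_one_le := h.map_one_le'
  le_map_one' := h.le_map_one
  map_one_le' := h.map_one_le
  tip_one := by rw [tip_comm, ← h.tip_map, h.tip_one]
  rms_map_le := h.rms_map_le'
  rms_map_le' := h.rms_map_le

theorem map_mono (h : IsBalancedPair Φ Ψ ε) {X X' : Matrix κ κ ℝ} (hX : X ≤ X') :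
    Φ X ≤ Φ X' := by
  have := h.map_nonneg _ (sub_nonneg.2 hX)
  rwa [map_sub, sub_nonneg] at this

theorem smul_one_le_map (h : IsBalancedPair Φ Ψ ε) {a : ℝ} (ha : 0 ≤ a) {X : Matrix κ κ ℝ}
    (hX : a • 1 ≤ X) : (a * (1 - ε)) • 1 ≤ Φ X := by
  refine le_trans ?_ (h.map_mono hX)
  rw [map_smul, ← smul_smul]
  exact smul_le_smul_of_posSemidef ha h.le_map_one

theorem map_le_smul_one (h : IsBalancedPair Φ Ψ ε) {b : ℝ} (hb : 0 ≤ b) {X : Matrix κ κ ℝ}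
    (hX : X ≤ b • 1) : Φ X ≤ (b * (1 + ε)) • 1 := by
  refine (h.map_mono hX).trans ?_
  rw [map_smul, ← smul_smul]
  exact smul_le_smul_of_posSemidef hb h.map_one_le

theorem isHermitian_map_one (h : IsBalancedPair Φ Ψ ε) : (Φ 1).IsHermitian :=
  (Matrix.nonneg_iff_posSemidef.1 (h.map_nonneg _
    (Matrix.nonneg_iff_posSemidef.2 Matrix.PosSemidef.one))).1

theorem rms_map_one_sub_le (h : IsBalancedPair Φ Ψ ε) (hε : 0 ≤ ε) : rms (Φ 1 - 1) ≤ ε := by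
  refine rms_le_of_le hε (h.isHermitian_map_one.sub Matrix.isHermitian_one) ?_ ?_
  · have := h.le_map_one
    rw [sub_smul, one_smul] at this
    rw [neg_smul, neg_le_sub_iff_le_add]
    exact sub_le_iff_le_add'.1 this |>.trans_eq (by abel)
  · have := h.map_one_le
    rw [add_smul, one_smul] at this
    exact sub_le_iff_le_add'.2 this

theorem one_le_rms_map_one [Nonempty ι] (h : IsBalancedPair Φ Ψ ε) : 1 ≤ rms (Φ 1) := by
  have := tip_le 1 (Φ 1)
  rwa [h.tip_one, rms_one, one_mul] at this

/-- The spectral gap of `Φ` on the orthogonal complement of the identity. -/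
theorem rms_map_le_of_tip_one_eq_zero [Nonempty ι] [Nonempty κ] (h : IsBalancedPair Φ Ψ ε)
    {lam : ℝ} (hlam : 0 < lam) (hlam1 : lam ≤ 1) (hε : 0 ≤ ε) (hεl : ε ≤ lam / 100)
    {p : Matrix κ κ ℝ →ₗ[ℝ] ℝ} (hp : ∀ W, p W = 0 → rms (Φ W) ≤ (1 - lam) * rms W)
    {D : Matrix κ κ ℝ} (hD : tip 1 D = 0) : rms (Φ D) ≤ (1 - 9 / 10 * lam) * rms D := by
  have hN := h.one_le_rms_map_one
  -- If `p` killed `1`, the gap would contradict `rms (Φ 1) ≥ 1`. Hence some multiple of `1` moves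
  -- `D` into the kernel of `p`.
  have hp1 : p 1 ≠ 0 := by
    intro h0
    have := hp 1 h0
    rw [rms_one] at this
    linarith
  set t : ℝ := -(p D / p 1) with ht
  have hW := hp (D + t • 1) (by
    rw [map_add, map_smul, ht, smul_eq_mul, neg_mul, div_mul_cancel₀ _ hp1, add_neg_cancel])
  have hW2 := pow_le_pow_left₀ (rms_nonneg _) hW 2
  have hd := rms_nonneg D
  have hg := rms_nonneg (Φ D)
  have e1 : rms (D + t • 1) ^ 2 = rms D ^ 2 + t ^ 2 := by
    rw [rms_sq, rms_sq, tip_add_left, tip_add_right, tip_add_right, tip_smul_left, tip_smul_left,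
      tip_smul_right, tip_smul_right, tip_comm D 1, hD, ← rms_sq (1 : Matrix κ κ ℝ), rms_one]
    ring
  have e2 : rms (Φ (D + t • 1)) ^ 2 =
      rms (Φ D) ^ 2 + 2 * t * tip (Φ 1) (Φ D) + t ^ 2 * rms (Φ 1) ^ 2 := by
    rw [map_add, map_smul, rms_sq, rms_sq, rms_sq, tip_add_left, tip_add_right, tip_add_right,
      tip_smul_left, tip_smul_left, tip_smul_right, tip_smul_right, tip_comm (Φ D) (Φ 1)]
    ring
  -- By adjointness and `tip 1 D = 0`, only the deviations of `Ψ 1` and `Φ 1` from the identity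
  -- contribute.
  have hc : |tip (Φ 1) (Φ D)| ≤ 3 * ε * rms D := by
    have e3 : tip (Φ 1) (Φ D) = tip (Ψ 1 - 1) D + tip (Φ 1 - 1) (Φ D) := by
      rw [tip_sub_left, tip_sub_left, hD, h.tip_map 1 D]
      ring
    rw [e3]
    refine (abs_add_le _ _).trans ?_
    have i1 := abs_tip_le (Ψ 1 - 1) D
    have i2 := abs_tip_le (Φ 1 - 1) (Φ D)
    have i3 := mul_le_mul_of_nonneg_right (h.symm.rms_map_one_sub_le hε) hd
    have i4 := mul_le_mul (h.rms_map_one_sub_le hε) (h.rms_map_le D) hg hε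
    nlinarith [mul_nonneg hε hd]
  rw [mul_pow, e1, e2] at hW2
  exact le_of_quadratic_le hlam hlam1 hd hεl hc hN hW2 (h.rms_map_le D)

/-- The spectral gap of `Φ` on the orthogonal complement of a matrix close to the identity. -/
theorem rms_map_le_of_tip_eq_zero [Nonempty ι] [Nonempty κ] (h : IsBalancedPair Φ Ψ ε)
    {lam : ℝ} (hlam : 0 < lam) (hlam1 : lam ≤ 1) (hε : 0 ≤ ε) (hεl : ε ≤ lam / 100)
    {p : Matrix κ κ ℝ →ₗ[ℝ] ℝ} (hp : ∀ W, p W = 0 → rms (Φ W) ≤ (1 - lam) * rms W)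
    {D P : Matrix κ κ ℝ} {δ : ℝ} (hP : rms (1 - P) ≤ δ) (hD : tip P D = 0) :
    rms (Φ D) ≤ (1 - 9 / 10 * lam + δ * (1 + ε)) * rms D := by
  set β := tip 1 D with hβ
  have hd := rms_nonneg D
  -- `D` is orthogonal to `P`, so its component along `1` only sees `1 - P`. The gap handles the
  -- rest of `D`.
  have hb : |β| ≤ δ * rms D := by
    have : β = tip (1 - P) D := by rw [tip_sub_left, hD, sub_zero]
    rw [this]
    exact (abs_tip_le _ _).trans (mul_le_mul_of_nonneg_right hP hd)
  have h11 : tip (1 : Matrix κ κ ℝ) 1 = 1 := by rw [← rms_sq, rms_one, one_pow]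
  have h0 : tip 1 (D - β • 1) = 0 := by
    rw [tip_sub_right, tip_smul_right, h11, ← hβ]
    ring
  have h1 := h.rms_map_le_of_tip_one_eq_zero hlam hlam1 hε hεl hp h0
  have h2 : rms (D - β • 1) ≤ rms D := by
    refine abs_le_of_sq_le_sq' ?_ hd |>.2
    rw [rms_sq, rms_sq, tip_sub_left, tip_smul_left, h0, tip_sub_right, tip_smul_right,
      tip_comm D 1]
    nlinarith [sq_nonneg β]
  have h3 : rms (Φ D) ≤ rms (Φ (D - β • 1)) + rms (Φ (β • 1)) := by
    conv_lhs => rw [← sub_add_cancel D (β • 1), map_add]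
    exact rms_add_le _ _
  have h4 : rms (Φ (β • 1)) ≤ (δ * rms D) * (1 + ε) := by
    rw [map_smul, rms_smul]
    have := h.rms_map_le 1
    rw [rms_one, mul_one] at this
    exact mul_le_mul hb this (rms_nonneg _) ((abs_nonneg _).trans hb)
  have h5 := mul_le_mul_of_nonneg_left h2 (by linarith : 0 ≤ 1 - 9 / 10 * lam)
  nlinarith

end IsBalancedPair

end BalancedPair

/-! ### The operator Sinkhorn iteration and its contraction. -/

theorem inv_mul_one_sub_le {x ε : ℝ} (hx : 0 < x) (hx1 : x ≤ 1) (hε : ε ≤ x / 1000) :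
    ((1 - x / 100) * (1 - ε))⁻¹ ≤ 1 + x / 80 := by
  have ha : 0 < 1 - x / 100 := by linarith
  have hx2 : x * x ≤ 1 * x := mul_le_mul_of_nonneg_right hx1 hx.le
  rw [inv_le_iff_one_le_mul₀ (mul_pos ha (by linarith))]
  have h1 : (1 - x / 100) * (1 - x / 1000) ≤ (1 - x / 100) * (1 - ε) :=
    mul_le_mul_of_nonneg_left (by linarith) ha.le
  have h2 : 1 - 11 / 1000 * x ≤ (1 - x / 100) * (1 - ε) := by linarith [mul_pos hx hx]
  have h3 := mul_le_mul_of_nonneg_left h2 (by linarith : 0 ≤ 1 + x / 80)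
  linarith

/-- The loss in one Sinkhorn round: two matrix inversions at `(1 + x/80)²` each, the norm `1 + ε` of
`Ψ`, and the gap factor of `Φ` on directions nearly orthogonal to `1`. -/
theorem contraction_factor_le {x ε : ℝ} (hx : 0 < x) (hx1 : x ≤ 1) (hε0 : 0 ≤ ε)
    (hε : ε ≤ x / 1000) :
    (1 + x / 80) ^ 2 * ((1 - 9 / 10 * x + x / 50 * (1 + ε)) * ((1 + x / 80) ^ 2 * (1 + ε))) ≤
      1 - x / 2 := by
  have hx2 : x * x ≤ 1 * x := mul_le_mul_of_nonneg_right hx1 hx.le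
  have hε2 : x * ε ≤ x * (1 / 1000) := mul_le_mul_of_nonneg_left (by linarith) hx.le
  have hε3 : 0 ≤ x * ε := mul_nonneg hx.le hε0
  have f0 : 0 ≤ 1 - 9 / 10 * x + x / 50 * (1 + ε) := by linarith
  have f1 : 1 - 9 / 10 * x + x / 50 * (1 + ε) ≤ 1 - 87 / 100 * x := by linarith
  have f2 : (1 + x / 80) ^ 2 ≤ 1 + 26 / 1000 * x := by linarith
  have f3 : (1 + x / 80) ^ 2 * (1 + ε) ≤ 1 + 3 / 100 * x := by
    have := mul_le_mul_of_nonneg_right f2 (by linarith : 0 ≤ 1 + ε)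
    linarith
  have f4 : (1 - 87 / 100 * x) * (1 + 3 / 100 * x) ≤ 1 - 84 / 100 * x := by
    linarith [mul_pos hx hx]
  calc _ ≤ (1 + 26 / 1000 * x) * ((1 - 87 / 100 * x) * (1 + 3 / 100 * x)) := by
        refine mul_le_mul f2 (mul_le_mul f1 f3 (by positivity) (by linarith))
          (mul_nonneg f0 (by positivity)) (by linarith)
    _ ≤ (1 + 26 / 1000 * x) * (1 - 84 / 100 * x) :=
        mul_le_mul_of_nonneg_left f4 (by linarith)
    _ ≤ 1 - x / 2 := by linarith [mul_pos hx hx]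

section Sinkhorn

variable {ι κ : Type*} [Fintype ι] [Fintype κ] [DecidableEq ι] [DecidableEq κ]
variable {Φ : Matrix κ κ ℝ →ₗ[ℝ] Matrix ι ι ℝ} {Ψ : Matrix ι ι ℝ →ₗ[ℝ] Matrix κ κ ℝ} {ε : ℝ}

theorem rms_inv_sub_inv_le {c : ℝ} (hc : 0 < c) {P Q : Matrix ι ι ℝ} (hP : P.PosDef)
    (hQ : Q.PosDef) (hPc : P⁻¹ ≤ c • 1) (hQc : Q⁻¹ ≤ c • 1) :
    rms (P⁻¹ - Q⁻¹) ≤ c ^ 2 * rms (P - Q) := by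
  have e : P⁻¹ - Q⁻¹ = P⁻¹ * (-(P - Q)) * Q⁻¹ := by
    rw [neg_sub, mul_sub, sub_mul, mul_assoc, Matrix.mul_nonsing_inv _ hQ.det_pos.ne'.isUnit,
      Matrix.nonsing_inv_mul _ hP.det_pos.ne'.isUnit, one_mul, mul_one]
  rw [e]
  refine (rms_mul_right_le hc (Matrix.nonneg_iff_posSemidef.2 hQ.inv.posSemidef) hQc _).trans ?_
  rw [sq, mul_assoc]
  refine mul_le_mul_of_nonneg_left ?_ hc.le
  refine (rms_mul_left_le hc (Matrix.nonneg_iff_posSemidef.2 hP.inv.posSemidef) hPc _).trans ?_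
  rw [rms_neg]

namespace IsBalancedPair

theorem posDef_map (h : IsBalancedPair Φ Ψ ε) (hε1 : ε < 1) {a : ℝ} (ha : 0 < a)
    {X : Matrix κ κ ℝ} (hX : a • 1 ≤ X) : (Φ X).PosDef :=
  posDef_of_smul_one_le (mul_pos ha (sub_pos.2 hε1)) (h.smul_one_le_map ha.le hX)

theorem inv_map_le (h : IsBalancedPair Φ Ψ ε) (hε1 : ε < 1) {a : ℝ} (ha : 0 < a)
    {X : Matrix κ κ ℝ} (hX : a • 1 ≤ X) : (Φ X)⁻¹ ≤ (a * (1 - ε))⁻¹ • 1 :=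
  inv_le_of_smul_one_le (mul_pos ha (sub_pos.2 hε1)) (h.smul_one_le_map ha.le hX)

theorem smul_one_le_inv_map (h : IsBalancedPair Φ Ψ ε) (hε : 0 ≤ ε) {b : ℝ}
    (hb : 0 < b) {X : Matrix κ κ ℝ} (hΦ : (Φ X).PosDef) (hX : X ≤ b • 1) :
    (b * (1 + ε))⁻¹ • 1 ≤ (Φ X)⁻¹ :=
  smul_one_le_inv hΦ (by positivity) (h.map_le_smul_one hb.le hX)

/-- One round of the operator Sinkhorn iteration contracts the increments. -/
theorem rms_sinkhorn_step_le [Nonempty ι] [Nonempty κ] (h : IsBalancedPair Φ Ψ ε)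
    {lam : ℝ} (hlam : 0 < lam) (hlam1 : lam ≤ 1) (hε : 0 ≤ ε) (hεl : ε ≤ lam / 1000)
    {p : Matrix κ κ ℝ →ₗ[ℝ] ℝ} (hp : ∀ W, p W = 0 → rms (Φ W) ≤ (1 - lam) * rms W)
    {Y Y' : Matrix ι ι ℝ} (hY : (1 - lam / 100) • 1 ≤ Y) (hY' : (1 - lam / 100) • 1 ≤ Y')
    (hYu' : Y' ≤ (1 + lam / 100) • 1) (hYY' : Y' = (Φ (Ψ Y)⁻¹)⁻¹) (hYu : Y ≤ (1 + lam / 100) • 1) :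
    rms ((Φ (Ψ Y')⁻¹)⁻¹ - Y') ≤ (1 - lam / 2) * rms (Y' - Y) := by
  have hε1 : ε < 1 := by linarith
  have ha : 0 < 1 - lam / 100 := by linarith
  have hb : 0 < 1 + lam / 100 := by linarith
  have hc : 0 < 1 + lam / 80 := by linarith
  have hΨ := h.symm.posDef_map hε1 ha hY
  have hΨ' := h.symm.posDef_map hε1 ha hY'
  have cX := inv_mul_one_sub_le hlam hlam1 hεl
  have hX := (h.symm.inv_map_le hε1 ha hY).trans (smul_one_le_smul_one cX)
  have hX' := (h.symm.inv_map_le hε1 ha hY').trans (smul_one_le_smul_one cX)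
  have hXl := h.symm.smul_one_le_inv_map hε hb hΨ hYu
  have hXl' := h.symm.smul_one_le_inv_map hε hb hΨ' hYu'
  have hbε : 0 < ((1 + lam / 100) * (1 + ε))⁻¹ := by positivity
  have hΦ := h.posDef_map hε1 hbε hXl
  have hΦ' := h.posDef_map hε1 hbε hXl'
  have cY : (((1 + lam / 100) * (1 + ε))⁻¹ * (1 - ε))⁻¹ ≤ 1 + lam / 80 := by
    rw [mul_inv, inv_inv, ← div_eq_mul_inv, div_le_iff₀ (by linarith)]
    nlinarith
  have hY2 := (h.inv_map_le hε1 hbε hXl').trans (smul_one_le_smul_one cY)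
  have hY1 : (Φ (Ψ Y)⁻¹)⁻¹ ≤ (1 + lam / 80) • 1 := by
    rw [← hYY']
    exact hYu'.trans (smul_one_le_smul_one (by linarith))
  have s1 : rms ((Ψ Y')⁻¹ - (Ψ Y)⁻¹) ≤ (1 + lam / 80) ^ 2 * ((1 + ε) * rms (Y' - Y)) := by
    refine (rms_inv_sub_inv_le hc hΨ' hΨ hX' hX).trans ?_
    rw [← map_sub]
    exact mul_le_mul_of_nonneg_left (h.rms_map_le' _) (by positivity)
  -- The decisive point: both terms pair with `Ψ Y'` to `1`, the second because `tip (Ψ Y') X = tip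
  -- Y' (Φ X)` and `Y' = (Φ X)⁻¹` for `X = (Ψ Y)⁻¹`. So the increment avoids the one direction
  -- without a gap.
  have orth : tip (Ψ Y') ((Ψ Y')⁻¹ - (Ψ Y)⁻¹) = 0 := by
    have sym : (Ψ Y')ᵀ = Ψ Y' := by simpa using hΨ'.1.eq
    have symY : Y'ᵀ = Y' := by
      simpa using (posDef_of_smul_one_le ha hY').1.eq
    rw [tip_sub_right, ← h.tip_map Y' (Ψ Y)⁻¹]
    unfold tip
    rw [sym, Matrix.mul_nonsing_inv _ hΨ'.det_pos.ne'.isUnit, symY]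
    conv_lhs => rw [hYY', Matrix.nonsing_inv_mul _ hΦ.det_pos.ne'.isUnit]
    simp
  have near : rms (1 - Ψ Y') ≤ lam / 50 := by
    refine rms_le_of_le (by positivity) (Matrix.isHermitian_one.sub hΨ'.1) ?_ ?_
    · have := h.symm.map_le_smul_one hb.le hYu'
      have := this.trans (smul_one_le_smul_one (b := 1 + lam / 50) (by nlinarith))
      rw [add_smul, one_smul] at this
      rw [neg_smul, neg_le_sub_iff_le_add]
      exact this.trans_eq (by abel)
    · have := h.symm.smul_one_le_map ha.le hY'
      have := (smul_one_le_smul_one (a := 1 - lam / 50) (by nlinarith)).trans this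
      rw [sub_smul, one_smul] at this
      exact sub_le_comm.1 this
  have s2 := h.rms_map_le_of_tip_eq_zero hlam hlam1 hε (by linarith) hp near orth
  have s3 : rms ((Φ (Ψ Y')⁻¹)⁻¹ - Y') ≤
      (1 + lam / 80) ^ 2 * rms (Φ ((Ψ Y')⁻¹ - (Ψ Y)⁻¹)) := by
    have e : (Φ (Ψ Y')⁻¹)⁻¹ - Y' = (Φ (Ψ Y')⁻¹)⁻¹ - (Φ (Ψ Y)⁻¹)⁻¹ := by rw [← hYY']
    rw [e, map_sub]
    exact rms_inv_sub_inv_le hc hΦ' hΦ hY2 hY1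
  have hd := rms_nonneg (Y' - Y)
  have f0 : 0 ≤ 1 - 9 / 10 * lam + lam / 50 * (1 + ε) := by linarith [mul_nonneg hlam.le hε]
  calc rms ((Φ (Ψ Y')⁻¹)⁻¹ - Y')
      ≤ (1 + lam / 80) ^ 2 * ((1 - 9 / 10 * lam + lam / 50 * (1 + ε)) *
          ((1 + lam / 80) ^ 2 * ((1 + ε) * rms (Y' - Y)))) :=
        s3.trans (mul_le_mul_of_nonneg_left (s2.trans (mul_le_mul_of_nonneg_left s1 f0))
          (by positivity))
    _ = ((1 + lam / 80) ^ 2 * ((1 - 9 / 10 * lam + lam / 50 * (1 + ε)) *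
          ((1 + lam / 80) ^ 2 * (1 + ε)))) * rms (Y' - Y) := by ring
    _ ≤ (1 - lam / 2) * rms (Y' - Y) :=
        mul_le_mul_of_nonneg_right (contraction_factor_le hlam hlam1 hε hεl) hd

end IsBalancedPair

/-- The operator Sinkhorn iteration, started at the identity. -/
noncomputable def sinkhorn (Φ : Matrix κ κ ℝ →ₗ[ℝ] Matrix ι ι ℝ)
    (Ψ : Matrix ι ι ℝ →ₗ[ℝ] Matrix κ κ ℝ) : ℕ → Matrix ι ι ℝ
  | 0 => 1
  | k + 1 => (Φ (Ψ (sinkhorn Φ Ψ k))⁻¹)⁻¹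

namespace IsBalancedPair

/-- Only positivity is used: inversion swaps the two bounds, so `Ψ` and `Φ` together widen each by
the factor `(1 + ε)/(1 - ε)`. -/
theorem sinkhorn_pow_bounds (h : IsBalancedPair Φ Ψ ε) (hε : 0 ≤ ε) (hε1 : ε < 1) (k : ℕ) :
    (((1 + ε) / (1 - ε)) ^ k)⁻¹ • 1 ≤ sinkhorn Φ Ψ k ∧
      sinkhorn Φ Ψ k ≤ ((1 + ε) / (1 - ε)) ^ k • 1 := by
  have h1 : 0 < 1 - ε := by linarith
  have hr : 0 < (1 + ε) / (1 - ε) := by positivity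
  induction k with
  | zero => simp [sinkhorn]
  | succ k ih =>
    obtain ⟨i1, i2⟩ := ih
    have hpos : 0 < (((1 + ε) / (1 - ε)) ^ k)⁻¹ := by positivity
    have hpos' : 0 < ((1 + ε) / (1 - ε)) ^ k := by positivity
    have hΨ := h.symm.posDef_map hε1 hpos i1
    have u := h.symm.inv_map_le hε1 hpos i1
    have l := h.symm.smul_one_le_inv_map hε hpos' hΨ i2
    have hpl : 0 < (((1 + ε) / (1 - ε)) ^ k * (1 + ε))⁻¹ := by positivity
    have hΦ := h.posDef_map hε1 hpl l
    constructor
    · refine le_trans (smul_one_le_smul_one ?_) (h.smul_one_le_inv_map hε (by positivity) hΦ u)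
      apply le_of_eq
      rw [pow_succ]
      field_simp
    · refine (h.inv_map_le hε1 hpl l).trans (smul_one_le_smul_one ?_)
      apply le_of_eq
      rw [pow_succ]
      field_simp

theorem sinkhorn_posDef (h : IsBalancedPair Φ Ψ ε) (hε : 0 ≤ ε) (hε1 : ε < 1) (k : ℕ) :
    (sinkhorn Φ Ψ k).PosDef := by
  have h1 : 0 < 1 - ε := by linarith
  exact posDef_of_smul_one_le (by positivity) (h.sinkhorn_pow_bounds hε hε1 k).1

theorem rms_sinkhorn_one_sub_le (h : IsBalancedPair Φ Ψ ε) (hε : 0 ≤ ε) (hε1 : ε ≤ 1 / 3) :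
    rms (sinkhorn Φ Ψ 1 - sinkhorn Φ Ψ 0) ≤ 3 * ε := by
  have h1 : 0 < 1 - ε := by linarith
  obtain ⟨l, u⟩ := h.sinkhorn_pow_bounds hε (by linarith) 1
  rw [pow_one] at l u
  have hr : (1 + ε) / (1 - ε) ≤ 1 + 3 * ε := by
    rw [div_le_iff₀ h1]
    nlinarith
  have hr' : 1 + -(3 * ε) ≤ ((1 + ε) / (1 - ε))⁻¹ := by
    rw [inv_div, le_div_iff₀ (by positivity)]
    nlinarith
  refine rms_le_of_le (by positivity)
    ((h.sinkhorn_posDef hε (by linarith) 1).1.sub Matrix.isHermitian_one) ?_ ?_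
  · have := (smul_one_le_smul_one hr').trans l
    rw [add_smul, one_smul] at this
    exact le_sub_iff_add_le'.2 this
  · have := u.trans (smul_one_le_smul_one hr)
    rw [add_smul, one_smul] at this
    exact sub_le_iff_le_add'.2 this

/-- The Sinkhorn iterates stay close to the identity and their increments decay geometrically. -/
theorem sinkhorn_bounds [Nonempty ι] [Nonempty κ] (h : IsBalancedPair Φ Ψ ε)
    {lam : ℝ} (hlam : 0 < lam) (hlam1 : lam ≤ 1) (hε : 0 ≤ ε) (hεl : ε ≤ lam ^ 2 / 1200)
    {p : Matrix κ κ ℝ →ₗ[ℝ] ℝ} (hp : ∀ W, p W = 0 → rms (Φ W) ≤ (1 - lam) * rms W)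
    {K : ℕ} (hK : √(Fintype.card ι) * (1 - lam / 2) ^ K ≤ 1)
    (hr : ((1 + ε) / (1 - ε)) ^ K ≤ 1 + lam / 200) (k : ℕ) :
    ((1 - lam / 100) • 1 ≤ sinkhorn Φ Ψ k ∧ sinkhorn Φ Ψ k ≤ (1 + lam / 100) • 1) ∧
      rms (sinkhorn Φ Ψ (k + 1) - sinkhorn Φ Ψ k) ≤ 3 * ε * (1 - lam / 2) ^ k := by
  have hεl' : ε ≤ lam / 1000 := by nlinarith
  have hε1 : ε < 1 := by linarith
  have hq : 0 ≤ 1 - lam / 2 := by linarith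
  have h1 : 0 < 1 - ε := by linarith
  have hr1 : 1 ≤ (1 + ε) / (1 - ε) := by
    rw [one_le_div h1]
    linarith
  induction k using Nat.strong_induction_on with
  | _ k ih =>
  -- Up to time `K` the gap-free bound suffices and spends half of the allowed distance `lam / 100`.
  have hsmall : ∀ j ≤ K, (1 - lam / 200) • 1 ≤ sinkhorn Φ Ψ j ∧
      sinkhorn Φ Ψ j ≤ (1 + lam / 200) • 1 := by
    intro j hj
    obtain ⟨l, u⟩ := h.sinkhorn_pow_bounds hε hε1 j
    have hrj : ((1 + ε) / (1 - ε)) ^ j ≤ 1 + lam / 200 :=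
      (pow_le_pow_right₀ hr1 hj).trans hr
    refine ⟨(smul_one_le_smul_one ?_).trans l, u.trans (smul_one_le_smul_one hrj)⟩
    rw [le_inv_comm₀ (by linarith) (by positivity)]
    refine hrj.trans ?_
    rw [inv_eq_one_div, le_div_iff₀ (by linarith)]
    linarith [mul_pos hlam hlam]
  have hbd : (1 - lam / 100) • 1 ≤ sinkhorn Φ Ψ k ∧ sinkhorn Φ Ψ k ≤ (1 + lam / 100) • 1 := by
    rcases le_total k K with hkK | hkK
    · obtain ⟨l, u⟩ := hsmall k hkK
      exact ⟨(smul_one_le_smul_one (by linarith)).trans l,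
        u.trans (smul_one_le_smul_one (by linarith))⟩
    -- Beyond `K` the geometric increments are summed. The factor `(1 - lam/2)^K` then cancels the
    -- loss `√|ι|`, and `6ε/lam ≤ lam/200` spends the other half.
    · have tail : ∀ j, K ≤ j → j ≤ k → rms (sinkhorn Φ Ψ j - sinkhorn Φ Ψ K) ≤
          6 * ε / lam * ((1 - lam / 2) ^ K - (1 - lam / 2) ^ j) := by
        intro j hj
        induction j, hj using Nat.le_induction with
        | base => intro _; simp [rms, tip]
        | succ j hj ihj =>
          intro hjk
          have e : sinkhorn Φ Ψ (j + 1) - sinkhorn Φ Ψ K =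
              (sinkhorn Φ Ψ (j + 1) - sinkhorn Φ Ψ j) +
                (sinkhorn Φ Ψ j - sinkhorn Φ Ψ K) := by abel
          rw [e]
          refine (rms_add_le _ _).trans
            ((add_le_add (ih j (by omega)).2 (ihj (by omega))).trans (le_of_eq ?_))
          field_simp
          ring
      have hc : √(Fintype.card ι) * rms (sinkhorn Φ Ψ k - sinkhorn Φ Ψ K) ≤ lam / 200 := by
        have t1 := tail k hkK le_rfl
        have t2 : 6 * ε / lam * ((1 - lam / 2) ^ K - (1 - lam / 2) ^ k) ≤
            6 * ε / lam * (1 - lam / 2) ^ K := by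
          refine mul_le_mul_of_nonneg_left ?_ (by positivity)
          linarith [pow_nonneg hq k]
        have t3 := mul_le_mul_of_nonneg_left (t1.trans t2) (Real.sqrt_nonneg (Fintype.card ι))
        have t4 : 6 * ε / lam * (√(Fintype.card ι) * (1 - lam / 2) ^ K) ≤ 6 * ε / lam * 1 :=
          mul_le_mul_of_nonneg_left hK (by positivity)
        have t5 : 6 * ε / lam ≤ lam / 200 := by
          rw [div_le_iff₀ hlam]
          linarith
        linarith
      have herm := (h.sinkhorn_posDef hε hε1 k).1.sub (h.sinkhorn_posDef hε hε1 K).1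
      obtain ⟨l, u⟩ := hsmall K le_rfl
      have u' := add_le_add (le_rms_smul_one herm hc) u
      have l' := add_le_add (neg_rms_smul_one_le herm hc) l
      rw [← add_smul, sub_add_cancel] at u' l'
      exact ⟨(smul_one_le_smul_one (by linarith)).trans l',
        u'.trans (smul_one_le_smul_one (by linarith))⟩
  refine ⟨hbd, ?_⟩
  cases k with
  | zero => simpa using h.rms_sinkhorn_one_sub_le hε (by linarith)
  | succ j =>
    obtain ⟨⟨l, u⟩, hj⟩ := ih j (by omega)
    have := h.rms_sinkhorn_step_le hlam hlam1 hε hεl' hp l hbd.1 hbd.2 rfl u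
    refine le_trans this ?_
    rw [pow_succ]
    have := mul_le_mul_of_nonneg_left hj hq
    linarith

end IsBalancedPair

end Sinkhorn

open Filter Topology

/-! ### Convergence of the iteration to a fixed point. -/

section Limits

variable {ι : Type*} [Fintype ι] [DecidableEq ι]

theorem isHermitian_of_tendsto {u : ℕ → Matrix ι ι ℝ} {L : Matrix ι ι ℝ}
    (hu : Tendsto u atTop (𝓝 L)) (h : ∀ k, (u k).IsHermitian) : L.IsHermitian := by
  have h1 : Tendsto (fun k => (u k)ᴴ) atTop (𝓝 Lᴴ) :=
    (continuous_id.matrix_conjTranspose.tendsto L).comp hu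
  have h2 : (fun k => (u k)ᴴ) = u := funext fun k => (h k).eq
  rw [h2] at h1
  exact tendsto_nhds_unique h1 hu

theorem posSemidef_of_tendsto {u : ℕ → Matrix ι ι ℝ} {L : Matrix ι ι ℝ}
    (hu : Tendsto u atTop (𝓝 L)) (h : ∀ k, (u k).PosSemidef) : L.PosSemidef := by
  refine Matrix.PosSemidef.of_dotProduct_mulVec_nonneg
    (isHermitian_of_tendsto hu fun k => (h k).1) fun x => ?_
  have h1 : Continuous fun M : Matrix ι ι ℝ => star x ⬝ᵥ (M *ᵥ x) := by fun_prop
  exact ge_of_tendsto' ((h1.tendsto L).comp hu) fun k => (h k).dotProduct_mulVec_nonneg x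

theorem exists_tendsto_of_rms_le {u : ℕ → Matrix ι ι ℝ} {C q : ℝ} (hq : q < 1)
    (h : ∀ k, rms (u (k + 1) - u k) ≤ C * q ^ k) : ∃ L, Tendsto u atTop (𝓝 L) := by
  have h1 : ∀ i j, ∃ l, Tendsto (fun k => u k i j) atTop (𝓝 l) := by
    intro i j
    refine cauchySeq_tendsto_of_complete
      (cauchySeq_of_le_geometric q (√(Fintype.card ι) * C) hq fun k => ?_)
    rw [dist_comm, Real.dist_eq, mul_assoc]
    exact (abs_apply_le (u (k + 1) - u k) i j).trans
      (mul_le_mul_of_nonneg_left (h k) (Real.sqrt_nonneg _))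
  choose L hL using h1
  exact ⟨L, tendsto_pi_nhds.2 fun i => tendsto_pi_nhds.2 fun j => hL i j⟩

end Limits

section FixedPoint

variable {ι κ : Type*} [Fintype ι] [Fintype κ] [DecidableEq ι] [DecidableEq κ]
variable {Φ : Matrix κ κ ℝ →ₗ[ℝ] Matrix ι ι ℝ} {Ψ : Matrix ι ι ℝ →ₗ[ℝ] Matrix κ κ ℝ} {ε : ℝ}

theorem tendsto_inv_of_posDef {u : ℕ → Matrix ι ι ℝ} {L : Matrix ι ι ℝ}
    (hu : Tendsto u atTop (𝓝 L)) (hL : L.PosDef) :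
    Tendsto (fun k => (u k)⁻¹) atTop (𝓝 L⁻¹) := by
  refine (continuousAt_matrix_inv L ?_).tendsto.comp hu
  have : Ring.inverse = fun x : ℝ => x⁻¹ := funext fun x => Ring.inverse_eq_inv x
  rw [this]
  exact continuousAt_inv₀ hL.det_pos.ne'

theorem tendsto_map (Φ : Matrix κ κ ℝ →ₗ[ℝ] Matrix ι ι ℝ) {u : ℕ → Matrix κ κ ℝ}
    {L : Matrix κ κ ℝ} (hu : Tendsto u atTop (𝓝 L)) :
    Tendsto (fun k => Φ (u k)) atTop (𝓝 (Φ L)) :=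
  ((LinearMap.continuous_of_finiteDimensional Φ).tendsto L).comp hu

namespace IsBalancedPair

/-- The Sinkhorn iteration has a fixed point close to the identity. -/
theorem exists_fixed_point [Nonempty ι] [Nonempty κ] (h : IsBalancedPair Φ Ψ ε)
    {lam : ℝ} (hlam : 0 < lam) (hlam1 : lam ≤ 1) (hε : 0 ≤ ε) (hεl : ε ≤ lam ^ 2 / 1200)
    {p : Matrix κ κ ℝ →ₗ[ℝ] ℝ} (hp : ∀ W, p W = 0 → rms (Φ W) ≤ (1 - lam) * rms W)
    {K : ℕ} (hK : √(Fintype.card ι) * (1 - lam / 2) ^ K ≤ 1)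
    (hr : ((1 + ε) / (1 - ε)) ^ K ≤ 1 + lam / 200) :
    ∃ Y : Matrix ι ι ℝ, (1 - lam / 100) • 1 ≤ Y ∧ Y ≤ (1 + lam / 100) • 1 ∧
      (Φ (Ψ Y)⁻¹)⁻¹ = Y := by
  have hb := h.sinkhorn_bounds hlam hlam1 hε hεl hp hK hr
  have hε1 : ε < 1 := by nlinarith
  obtain ⟨Y, hY⟩ := exists_tendsto_of_rms_le (by linarith) fun k => (hb k).2
  have l : (1 - lam / 100) • 1 ≤ Y := by
    refine posSemidef_of_tendsto (hY.sub_const _) fun k => (hb k).1.1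
  have u : Y ≤ (1 + lam / 100) • 1 := by
    refine posSemidef_of_tendsto (hY.const_sub _) fun k => (hb k).1.2
  refine ⟨Y, l, u, ?_⟩
  have ha : 0 < 1 - lam / 100 := by linarith
  have hΨ := h.symm.posDef_map hε1 ha l
  have hX := h.symm.smul_one_le_inv_map hε (by positivity) hΨ u
  have hΦ := h.posDef_map hε1 (by positivity) hX
  have t1 := tendsto_inv_of_posDef (tendsto_map Φ (tendsto_inv_of_posDef (tendsto_map Ψ hY) hΨ)) hΦ
  -- Both limits are of the same sequence, the iterates shifted by one round.
  exact tendsto_nhds_unique t1 (hY.comp (tendsto_add_atTop_nat 1))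

end IsBalancedPair

end FixedPoint

/-! ### Second-order bound for the potential at a fixed point. -/

section Value

theorem abs_log_one_add_le {u : ℝ} (hu : |u| < 1) :
    |Real.log (1 + u) - (u - u ^ 2 / 2)| ≤ |u| ^ 3 / (1 - |u|) := by
  have := Real.abs_log_sub_add_sum_range_le (x := -u) (by rwa [abs_neg]) 2
  rw [abs_neg] at this
  convert this using 2
  norm_num [Finset.sum_range_succ]
  ring

/-- The cubic Taylor remainder is absorbed by giving up `x/20` of the quadratic coefficient `1/2`,
less than what the gap will supply. -/
theorem log_le_of_abs_le {x y : ℝ} (hx1 : x ≤ 1) (h : |y - 1| ≤ x / 30) :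
    Real.log y ≤ (y - 1) - (1 / 2 - x / 20) * (y - 1) ^ 2 := by
  have h1 := (abs_le.1 (abs_log_one_add_le (u := y - 1) (by linarith))).2
  rw [add_sub_cancel] at h1
  have h2 : |y - 1| ^ 3 / (1 - |y - 1|) ≤ x / 20 * (y - 1) ^ 2 := by
    rw [div_le_iff₀ (by linarith), pow_succ, sq_abs]
    have : |y - 1| ≤ x / 20 * (1 - |y - 1|) := by nlinarith [abs_nonneg (y - 1)]
    nlinarith [mul_le_mul_of_nonneg_left this (sq_nonneg (y - 1))]
  linarith

theorem le_log_of_abs_le {y : ℝ} (h : |y - 1| ≤ 1 / 2) :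
    (y - 1) - 3 / 2 * (y - 1) ^ 2 ≤ Real.log y := by
  have h1 := (abs_le.1 (abs_log_one_add_le (u := y - 1) (by linarith))).1
  rw [add_sub_cancel] at h1
  have h2 : |y - 1| ^ 3 / (1 - |y - 1|) ≤ (y - 1) ^ 2 := by
    rw [div_le_iff₀ (by linarith), pow_succ, sq_abs]
    exact mul_le_mul_of_nonneg_left (by linarith) (sq_nonneg _)
  linarith

variable {ι κ : Type*} [Fintype ι] [Fintype κ] [DecidableEq ι] [DecidableEq κ]
variable {Φ : Matrix κ κ ℝ →ₗ[ℝ] Matrix ι ι ℝ} {Ψ : Matrix ι ι ℝ →ₗ[ℝ] Matrix κ κ ℝ} {ε : ℝ}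

theorem tip_one_left (A : Matrix ι ι ℝ) : tip 1 A = A.trace / Fintype.card ι := by
  simp [tip]

theorem tip_self_of_isHermitian {A : Matrix ι ι ℝ} (hA : A.IsHermitian) :
    tip A A = (A * A).trace / Fintype.card ι := by
  have : Aᵀ = A := by simpa using hA.eq
  rw [tip, this]

theorem log_det_div_le {x : ℝ} (hx1 : x ≤ 1) {P : Matrix ι ι ℝ}
    (l : (1 - x / 30) • 1 ≤ P) (u : P ≤ (1 + x / 30) • 1) :
    Real.log P.det / Fintype.card ι ≤
      tip 1 (P - 1) - (1 / 2 - x / 20) * tip (P - 1) (P - 1) := by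
  have hP : P.PosDef := posDef_of_smul_one_le (by linarith) l
  have := log_det_le hP (η := 1 / 2 - x / 20) fun i => log_le_of_abs_le hx1 (by
    rw [abs_le]
    constructor <;> linarith [eigenvalues_le_of_le hP.1 u i, le_eigenvalues_of_le hP.1 l i])
  rw [tip_one_left, tip_self_of_isHermitian (hP.1.sub Matrix.isHermitian_one), mul_div_assoc',
    ← sub_div]
  exact div_le_div_of_nonneg_right this (Nat.cast_nonneg _)

theorem le_log_det_div {P : Matrix ι ι ℝ}
    (l : (1 - ε) • 1 ≤ P) (u : P ≤ (1 + ε) • 1) (hε : ε ≤ 1 / 2) :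
    tip 1 (P - 1) - 3 / 2 * tip (P - 1) (P - 1) ≤ Real.log P.det / Fintype.card ι := by
  have hP : P.PosDef := posDef_of_smul_one_le (by linarith) l
  have := le_log_det hP (η := 3 / 2) fun i => le_log_of_abs_le (by
    rw [abs_le]
    constructor <;> linarith [eigenvalues_le_of_le hP.1 u i, le_eigenvalues_of_le hP.1 l i])
  rw [tip_one_left, tip_self_of_isHermitian (hP.1.sub Matrix.isHermitian_one), mul_div_assoc',
    ← sub_div]
  exact div_le_div_of_nonneg_right this (Nat.cast_nonneg _)

/-- After `ab ≤ (a² + b²)/2`, the squares keep coefficient `-(1/2 - x/20) + (1/2 - 9x/20) = -2x/5`.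
Maximizing `(31/30) ε c - (2/5) x c²` at `c = a` and `c = b` costs at most `ε²/x` each. -/
theorem quadratic_bound {x ε a b α ψ : ℝ} (hx : 0 < x) (hx1 : x ≤ 1) (hε : 0 ≤ ε)
    (hb : 0 ≤ b) (hα' : |α| ≤ x / 30)
    (hα : α ≤ ε * b * (1 + |α|) + ε * a + (1 - 9 / 10 * x) * (a * b))
    (ha : 0 ≤ a)
    (hψ : ψ ≤ α - (1 / 2 - x / 20) * (α ^ 2 + a ^ 2) - (1 / 2 - x / 20) * b ^ 2) :
    ψ ≤ 2 * ε ^ 2 / x := by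
  have h1 : ε * b * (1 + |α|) ≤ ε * b * (31 / 30) :=
    mul_le_mul_of_nonneg_left (by linarith) (mul_nonneg hε hb)
  have h2 : (1 - 9 / 10 * x) * (a * b) ≤ (1 - 9 / 10 * x) * ((a ^ 2 + b ^ 2) / 2) :=
    mul_le_mul_of_nonneg_left (by nlinarith [sq_nonneg (a - b)]) (by linarith)
  have h3 : 0 ≤ (1 / 2 - x / 20) * α ^ 2 := mul_nonneg (by linarith) (sq_nonneg _)
  have h4 : ∀ c : ℝ, 31 / 30 * (ε * c) - 2 / 5 * (x * c ^ 2) ≤ ε ^ 2 / x := by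
    intro c
    rw [le_div_iff₀ hx]
    nlinarith [sq_nonneg (5 / 8 * (31 / 30) * ε - x * c * (1 / 2)), sq_nonneg (x * c),
      sq_nonneg (2 / 3 * ε - 3 / 5 * (x * c)), sq_nonneg ε, sq_nonneg (31 / 30 * ε - 4 / 5 * (x * c))]
  have h5 := h4 a
  have h6 := h4 b
  have h7 : ε * a ≤ 31 / 30 * (ε * a) := by nlinarith [mul_nonneg hε ha]
  have h8 : 2 * ε ^ 2 / x = ε ^ 2 / x + ε ^ 2 / x := by ring
  rw [h8]
  linarith

theorem smul_mem_of_le {P : Matrix ι ι ℝ} {c a b a' b' : ℝ} (hc : 0 ≤ c) (h1 : a • 1 ≤ P)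
    (h2 : P ≤ b • 1) (h3 : a' ≤ c * a) (h4 : c * b ≤ b') :
    a' • 1 ≤ c • P ∧ c • P ≤ b' • 1 := by
  have i1 := smul_le_smul_of_posSemidef hc h1
  have i2 := smul_le_smul_of_posSemidef hc h2
  rw [smul_smul] at i1 i2
  exact ⟨(smul_one_le_smul_one h3).trans i1, i2.trans (smul_one_le_smul_one h4)⟩

namespace IsBalancedPair

/-- Write `X = 1 + V` and `Y = 1 + α + U₀` with `V` and `U₀` of trace zero. The only surviving
first-order term is `α`, and `tip Y (Φ X) = 1` expresses it by the defects of `Φ 1`, `Ψ 1` and the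
cross term `tip U₀ (Φ V)`, to which the gap applies. -/
theorem log_det_add_log_det_le_of_tip_one [Nonempty ι] [Nonempty κ] (h : IsBalancedPair Φ Ψ ε)
    {lam : ℝ} (hlam : 0 < lam) (hlam1 : lam ≤ 1) (hε : 0 ≤ ε) (hεl : ε ≤ lam / 100)
    {p : Matrix κ κ ℝ →ₗ[ℝ] ℝ} (hp : ∀ W, p W = 0 → rms (Φ W) ≤ (1 - lam) * rms W)
    {X : Matrix κ κ ℝ} {Y : Matrix ι ι ℝ} (hXl : (1 - lam / 30) • 1 ≤ X)
    (hXu : X ≤ (1 + lam / 30) • 1) (hYl : (1 - lam / 30) • 1 ≤ Y)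
    (hYu : Y ≤ (1 + lam / 30) • 1) (hX1 : tip 1 X = 1) (hXY : tip Y (Φ X) = 1) :
    Real.log Y.det / Fintype.card ι + Real.log X.det / Fintype.card κ ≤ 2 * ε ^ 2 / lam := by
  have h11 : tip (1 : Matrix ι ι ℝ) 1 = 1 := by rw [← rms_sq, rms_one, one_pow]
  have h11' : tip (1 : Matrix κ κ ℝ) 1 = 1 := by rw [← rms_sq, rms_one, one_pow]
  have i1 := log_det_div_le hlam1 hXl hXu
  have i2 := log_det_div_le hlam1 hYl hYu
  have hYd := posDef_of_smul_one_le (by linarith) hYl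
  have rU : rms (Y - 1) ≤ lam / 30 := by
    refine rms_le_of_le (by positivity) (hYd.1.sub Matrix.isHermitian_one) ?_ ?_
    · rw [sub_smul, one_smul] at hYl
      rw [neg_smul, neg_le_sub_iff_le_add]
      exact sub_le_iff_le_add.1 hYl
    · rw [add_smul, one_smul] at hYu
      exact sub_le_iff_le_add'.2 hYu
  set V := X - 1 with hV
  set U := Y - 1 with hU
  have hV1 : tip 1 V = 0 := by rw [hV, tip_sub_right, hX1, h11', sub_self]
  set α := tip 1 U with hα
  set U₀ := U - α • 1 with hU₀
  have hU₀1 : tip 1 U₀ = 0 := by rw [hU₀, tip_sub_right, tip_smul_right, h11, ← hα]; ring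
  have hUe : U = U₀ + α • 1 := by rw [hU₀, sub_add_cancel]
  have hUU : tip U U = α ^ 2 + rms U₀ ^ 2 := by
    rw [hUe, rms_sq, tip_add_left, tip_add_right, tip_add_right, tip_smul_left, tip_smul_left,
      tip_smul_right, tip_smul_right, tip_comm U₀ 1, hU₀1, h11]
    ring
  have hα' : |α| ≤ lam / 30 := by
    refine (abs_tip_le 1 U).trans ?_
    rwa [rms_one, one_mul]
  have key : α = -(tip (Ψ 1 - 1) V * (1 + α) + tip U₀ (Φ 1 - 1) + tip U₀ (Φ V)) := by
    have e1 : Y = 1 + (U₀ + α • 1) := by rw [← hUe, hU]; abel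
    have e2 : X = 1 + V := by rw [hV]; abel
    rw [e1, e2, map_add] at hXY
    simp only [tip_add_left, tip_add_right, tip_smul_left, h.tip_one] at hXY
    rw [h.tip_map 1 V] at hXY
    rw [tip_sub_left (Ψ 1) 1 V, hV1, tip_sub_right U₀ (Φ 1) 1, tip_comm U₀ 1, hU₀1]
    linarith
  have b1 : |tip (Ψ 1 - 1) V| ≤ ε * rms V :=
    (abs_tip_le _ _).trans
      (mul_le_mul_of_nonneg_right (h.symm.rms_map_one_sub_le hε) (rms_nonneg _))
  have b2 : |tip U₀ (Φ 1 - 1)| ≤ ε * rms U₀ := by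
    rw [mul_comm]
    exact (abs_tip_le _ _).trans
      (mul_le_mul_of_nonneg_left (h.rms_map_one_sub_le hε) (rms_nonneg _))
  have b3 : |tip U₀ (Φ V)| ≤ (1 - 9 / 10 * lam) * (rms U₀ * rms V) := by
    have := mul_le_mul_of_nonneg_left
      (h.rms_map_le_of_tip_one_eq_zero hlam hlam1 hε hεl hp hV1) (rms_nonneg U₀)
    refine (abs_tip_le _ _).trans (this.trans_eq (by ring))
  refine quadratic_bound hlam hlam1 hε (rms_nonneg V) hα' ?_ (rms_nonneg U₀) ?_
  · have b4 : |tip (Ψ 1 - 1) V * (1 + α)| ≤ ε * rms V * (1 + |α|) := by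
      rw [abs_mul]
      refine mul_le_mul b1 ?_ (abs_nonneg _) (mul_nonneg hε (rms_nonneg _))
      exact (abs_add_le _ _).trans_eq (by rw [abs_one])
    linarith [neg_abs_le (tip (Ψ 1 - 1) V * (1 + α)), neg_abs_le (tip U₀ (Φ 1 - 1)),
      neg_abs_le (tip U₀ (Φ V))]
  · rw [hUU] at i2
    rw [hV1, ← rms_sq] at i1
    linarith

/-- At a fixed point of the Sinkhorn iteration near the identity, the potential is small. -/
theorem log_det_add_log_det_le [Nonempty ι] [Nonempty κ] (h : IsBalancedPair Φ Ψ ε)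
    {lam : ℝ} (hlam : 0 < lam) (hlam1 : lam ≤ 1) (hε : 0 ≤ ε) (hεl : ε ≤ lam / 1000)
    {p : Matrix κ κ ℝ →ₗ[ℝ] ℝ} (hp : ∀ W, p W = 0 → rms (Φ W) ≤ (1 - lam) * rms W)
    {Y : Matrix ι ι ℝ} (hYl : (1 - lam / 100) • 1 ≤ Y)
    (hYu : Y ≤ (1 + lam / 100) • 1) (hY : (Φ (Ψ Y)⁻¹)⁻¹ = Y) :
    Real.log Y.det / Fintype.card ι + Real.log (Ψ Y)⁻¹.det / Fintype.card κ ≤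
      2 * ε ^ 2 / lam := by
  have hε1 : ε < 1 := by linarith
  have ha : 0 < 1 - lam / 100 := by linarith
  have hYd := posDef_of_smul_one_le ha hYl
  have hΨ := h.symm.posDef_map hε1 ha hYl
  have hXu := (h.symm.inv_map_le hε1 ha hYl).trans
    (smul_one_le_smul_one (inv_mul_one_sub_le hlam hlam1 hεl))
  have hXl := h.symm.smul_one_le_inv_map hε (by positivity) hΨ hYu
  have hΦ := h.posDef_map hε1 (by positivity) hXl
  have hXl' : (1 - lam / 80) • 1 ≤ (Ψ Y)⁻¹ := by
    refine (smul_one_le_smul_one ?_).trans hXl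
    rw [inv_eq_one_div, le_div_iff₀ (by positivity)]
    have h1 : (1 + lam / 100) * (1 + ε) ≤ 1 + lam / 80 := by nlinarith
    have := mul_le_mul_of_nonneg_left h1 (by linarith : 0 ≤ 1 - lam / 80)
    nlinarith
  set X := (Ψ Y)⁻¹ with hX
  have hXd : X.PosDef := hΨ.inv
  set τ := tip 1 X with hτ
  have cκ : (0 : ℝ) < Fintype.card κ := by exact_mod_cast Fintype.card_pos
  have cι : (0 : ℝ) < Fintype.card ι := by exact_mod_cast Fintype.card_pos
  have τl : 1 - lam / 80 ≤ τ := by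
    rw [hτ, tip_one_left, le_div_iff₀ cκ]
    simpa using trace_le_trace hXl'
  have τu : τ ≤ 1 + lam / 80 := by
    rw [hτ, tip_one_left, div_le_iff₀ cκ]
    simpa using trace_le_trace hXu
  have τ0 : 0 < τ := by linarith
  have hYΦ : tip Y (Φ X) = 1 := by
    have symY : Yᵀ = Y := by simpa using hYd.1.eq
    rw [tip, symY]
    conv_lhs => rw [← hY]
    rw [Matrix.nonsing_inv_mul _ hΦ.det_pos.ne'.isUnit]
    simp
  -- Replacing `(X, Y)` by `(τ⁻¹ X, τ Y)` gives `X` normalized trace `1` and changes neither `tip Y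
  -- (Φ X)` nor the sum of the normalized log-determinants.
  have sX := smul_mem_of_le (inv_nonneg.2 τ0.le) hXl' hXu (a' := 1 - lam / 30) (b' := 1 + lam / 30)
    (by rw [inv_mul_eq_div, le_div_iff₀ τ0]; nlinarith)
    (by rw [inv_mul_eq_div, div_le_iff₀ τ0]; nlinarith)
  have sY := smul_mem_of_le τ0.le hYl hYu (a' := 1 - lam / 30) (b' := 1 + lam / 30)
    (by nlinarith) (by nlinarith)
  have main := h.log_det_add_log_det_le_of_tip_one hlam hlam1 hε (by linarith) hp sX.1 sX.2
    sY.1 sY.2 (by rw [tip_smul_right, ← hτ, inv_mul_cancel₀ τ0.ne'])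
    (by rw [map_smul, tip_smul_left, tip_smul_right, hYΦ, mul_one, mul_inv_cancel₀ τ0.ne'])
  have e1 : Real.log (τ • Y).det / Fintype.card ι =
      Real.log τ + Real.log Y.det / Fintype.card ι := by
    rw [Matrix.det_smul, Real.log_mul (pow_pos τ0 _).ne' hYd.det_pos.ne', Real.log_pow]
    field_simp
  have e2 : Real.log (τ⁻¹ • X).det / Fintype.card κ =
      -Real.log τ + Real.log X.det / Fintype.card κ := by
    rw [Matrix.det_smul, Real.log_mul (pow_pos (inv_pos.2 τ0) _).ne' hXd.det_pos.ne',
      Real.log_pow, Real.log_inv]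
    field_simp
  rw [e1, e2] at main
  linarith

end IsBalancedPair

end Value

/-! ### Simultaneous diagonalization by congruence. -/

section Diagonalization

variable {ι κ : Type*} [Fintype ι] [Fintype κ] [DecidableEq ι] [DecidableEq κ]

theorem exists_eq_mul_transpose {P : Matrix ι ι ℝ} (hP : P.PosDef) :
    ∃ R : Matrix ι ι ℝ, P = R * Rᵀ := by
  obtain ⟨U, h1, h2, h3⟩ := exists_orthogonal_conj_eq_diagonal hP.1
  refine ⟨U * Matrix.diagonal fun i => √(hP.1.eigenvalues i), ?_⟩
  rw [Matrix.transpose_mul, Matrix.diagonal_transpose]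
  conv_lhs => rw [h3]
  have : Matrix.diagonal hP.1.eigenvalues = Matrix.diagonal (fun i => √(hP.1.eigenvalues i)) *
      Matrix.diagonal (fun i => √(hP.1.eigenvalues i)) := by
    rw [Matrix.diagonal_mul_diagonal]
    congr 1
    ext i
    exact (Real.mul_self_sqrt (hP.eigenvalues_pos i).le).symm
  rw [this]
  simp only [mul_assoc]

/-- Two positive definite matrices can be diagonalized simultaneously by congruence. -/
theorem exists_simultaneous_diagonalization {P Q : Matrix ι ι ℝ} (hP : P.PosDef)
    (hQ : Q.PosDef) : ∃ (S : Matrix ι ι ℝ) (z : ι → ℝ), IsUnit S.det ∧ (∀ i, 0 < z i) ∧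
      P = S * Sᵀ ∧ Q = S * Matrix.diagonal z * Sᵀ := by
  obtain ⟨R, hR⟩ := exists_eq_mul_transpose hP
  have hRu : IsUnit R.det := by
    refine isUnit_iff_ne_zero.2 fun h0 => hP.det_pos.ne' ?_
    rw [hR, Matrix.det_mul, h0, zero_mul]
  have hRu' : IsUnit Rᵀ.det := by rwa [Matrix.det_transpose]
  have hZ : (R⁻¹ * Q * (R⁻¹)ᵀ).PosDef := by
    have := hQ.mul_mul_conjTranspose_same (B := R⁻¹)
      (Matrix.vecMul_injective_of_isUnit ((Matrix.isUnit_nonsing_inv_iff).2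
        ((Matrix.isUnit_iff_isUnit_det R).2 hRu)))
    rwa [Matrix.conjTranspose_eq_transpose_of_trivial] at this
  obtain ⟨U, h1, h2, h3⟩ := exists_orthogonal_conj_eq_diagonal hZ.1
  refine ⟨R * U, hZ.1.eigenvalues, ?_, hZ.eigenvalues_pos, ?_, ?_⟩
  · rw [Matrix.det_mul]
    refine hRu.mul (isUnit_iff_ne_zero.2 fun h0 => ?_)
    have := congrArg Matrix.det h2
    rw [Matrix.det_mul, h0, zero_mul, Matrix.det_one] at this
    exact zero_ne_one this
  · rw [Matrix.transpose_mul, mul_assoc, ← mul_assoc U, h2, one_mul, hR]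
  · have e : R * U * Matrix.diagonal hZ.1.eigenvalues * (R * U)ᵀ =
        R * (U * Matrix.diagonal hZ.1.eigenvalues * Uᵀ) * Rᵀ := by
      rw [Matrix.transpose_mul]
      simp only [mul_assoc]
    rw [e, ← h3, Matrix.transpose_nonsing_inv]
    have : R * (R⁻¹ * Q * Rᵀ⁻¹) * Rᵀ = (R * R⁻¹) * Q * (Rᵀ⁻¹ * Rᵀ) := by
      simp only [mul_assoc]
    rw [this, Matrix.mul_nonsing_inv _ hRu, Matrix.nonsing_inv_mul _ hRu', one_mul, mul_one]

theorem log_det_conj_diagonal {S : Matrix ι ι ℝ} (hS : IsUnit S.det) {z : ι → ℝ}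
    (hz : ∀ i, 0 < z i) : Real.log (S * Matrix.diagonal z * Sᵀ).det =
      ∑ i, Real.log (z i) + Real.log (S * Sᵀ).det := by
  rw [Matrix.det_mul, Matrix.det_mul, Matrix.det_mul, Matrix.det_transpose,
    Matrix.det_diagonal, mul_right_comm, mul_comm, Real.log_mul, Real.log_prod]
  · exact fun i _ => (hz i).ne'
  · exact (Finset.prod_pos fun i _ => hz i).ne'
  · exact mul_ne_zero hS.ne_zero hS.ne_zero

end Diagonalization

/-! ### Optimality of a Sinkhorn fixed point. -/

section FixedPointCapacity

variable {ι κ : Type*} [Fintype ι] [Fintype κ] [DecidableEq ι] [DecidableEq κ]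
variable {Φ : Matrix κ κ ℝ →ₗ[ℝ] Matrix ι ι ℝ} {Ψ : Matrix ι ι ℝ →ₗ[ℝ] Matrix κ κ ℝ}

/-- `X` dominates a positive multiple of `X₀`, namely its smallest relative eigenvalue, and `Φ` is
monotone. -/
theorem posDef_map_of_posDef_map [Nonempty κ] (hpos : ∀ X, 0 ≤ X → 0 ≤ Φ X) {X₀ X : Matrix κ κ ℝ}
    (hX₀ : X₀.PosDef) (hX : X.PosDef) (hΦ : (Φ X₀).PosDef) : (Φ X).PosDef := by
  obtain ⟨S, z, hS, hz, h1, h2⟩ := exists_simultaneous_diagonalization hX₀ hX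
  obtain ⟨j, hj⟩ := Finite.exists_min z
  have h3 : 0 ≤ X - z j • X₀ := by
    have e : X - z j • X₀ = S * Matrix.diagonal (fun i => z i - z j) * Sᵀ := by
      have : Matrix.diagonal (fun i => z i - z j) = Matrix.diagonal z - z j • 1 := by
        ext a b
        by_cases hab : a = b
        · subst hab; simp
        · simp [hab]
      rw [this, mul_sub, sub_mul, ← h2, mul_smul_comm, smul_mul_assoc, mul_one, ← h1]
    rw [e, Matrix.nonneg_iff_posSemidef, ← Matrix.conjTranspose_eq_transpose_of_trivial]
    refine Matrix.PosSemidef.mul_mul_conjTranspose_same ?_ S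
    exact Matrix.PosSemidef.diagonal fun i => sub_nonneg.2 (hj i)
  have h4 := hpos _ h3
  rw [map_sub, map_smul, Matrix.nonneg_iff_posSemidef] at h4
  have : Φ X = z j • Φ X₀ + (Φ X - z j • Φ X₀) := by abel
  rw [this]
  exact (hΦ.smul (hz j)).add_posSemidef h4

/-- At a fixed point of the Sinkhorn iteration, the normalized capacity functional is minimal. -/
theorem log_det_div_le_of_fixed_point [Nonempty ι] [Nonempty κ]
    (hpos : ∀ X, 0 ≤ X → 0 ≤ Φ X) (htip : ∀ Y X, tip Y (Φ X) = tip (Ψ Y) X)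
    {X₀ : Matrix κ κ ℝ} {Y₀ : Matrix ι ι ℝ} (hX₀ : X₀.PosDef) (hY₀ : Y₀.PosDef)
    (hΦ : Φ X₀ = Y₀⁻¹) (hΨ : Ψ Y₀ = X₀⁻¹) {X : Matrix κ κ ℝ} (hX : X.PosDef) :
    Real.log X.det / Fintype.card κ -
        (Real.log Y₀.det / Fintype.card ι + Real.log X₀.det / Fintype.card κ) ≤
      Real.log (Φ X).det / Fintype.card ι := by
  have cκ : (0 : ℝ) < Fintype.card κ := by exact_mod_cast Fintype.card_pos
  have cι : (0 : ℝ) < Fintype.card ι := by exact_mod_cast Fintype.card_pos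
  have hΦd : (Φ X₀).PosDef := hΦ ▸ hY₀.inv
  have hM := posDef_map_of_posDef_map hpos hX₀ hX hΦd
  obtain ⟨S, z, hS, hz, h1, h2⟩ := exists_simultaneous_diagonalization hX₀ hX
  obtain ⟨T, w, hT, hw, h3, h4⟩ := exists_simultaneous_diagonalization hΦd hM
  have hT' : IsUnit Tᵀ.det := by rwa [Matrix.det_transpose]
  have hS' : IsUnit Sᵀ.det := by rwa [Matrix.det_transpose]
  set E : κ → Matrix κ κ ℝ := fun j => S * Matrix.diagonal (Pi.single j 1) * Sᵀ with hE
  have hEpos : ∀ j, 0 ≤ E j := by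
    intro j
    rw [hE, Matrix.nonneg_iff_posSemidef]
    dsimp only
    rw [← Matrix.conjTranspose_eq_transpose_of_trivial]
    refine Matrix.PosSemidef.mul_mul_conjTranspose_same (Matrix.PosSemidef.diagonal ?_) S
    exact Pi.single_nonneg.2 zero_le_one
  have hsum : ∀ c : κ → ℝ, ∑ j, c j • E j = S * Matrix.diagonal c * Sᵀ := by
    intro c
    have : Matrix.diagonal c = ∑ j, c j • Matrix.diagonal (Pi.single j (1 : ℝ)) := by
      ext a b
      by_cases hab : a = b
      · subst hab; simp [Matrix.sum_apply, Pi.single_apply]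
      · simp [hab, Matrix.sum_apply]
    rw [this, Finset.mul_sum, Finset.sum_mul]
    exact Finset.sum_congr rfl fun j _ => by rw [hE, mul_smul_comm, smul_mul_assoc]
  -- In the diagonalizing frames `Φ` yields a nonnegative matrix with `w = P z`. Rows sum to `1`
  -- because `Φ X₀ = T Tᵀ`; columns sum to `|ι|/|κ|` by adjointness and `Ψ Y₀ = X₀⁻¹`. Jensen in
  -- each row, summed over rows, then compares the mean logarithms.
  set P : ι → κ → ℝ := fun a j => (T⁻¹ * Φ (E j) * Tᵀ⁻¹) a a with hPdef
  have hconj : ∀ D : Matrix ι ι ℝ, T⁻¹ * (T * D * Tᵀ) * Tᵀ⁻¹ = D := by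
    intro D
    have : T⁻¹ * (T * D * Tᵀ) * Tᵀ⁻¹ = (T⁻¹ * T) * D * (Tᵀ * Tᵀ⁻¹) := by simp only [mul_assoc]
    rw [this, Matrix.nonsing_inv_mul _ hT, Matrix.mul_nonsing_inv _ hT', one_mul, mul_one]
  have hlin : ∀ (c : κ → ℝ) (a : ι), ∑ j, P a j * c j =
      (T⁻¹ * Φ (S * Matrix.diagonal c * Sᵀ) * Tᵀ⁻¹) a a := by
    intro c a
    rw [← hsum, map_sum, Finset.mul_sum, Finset.sum_mul, Matrix.sum_apply]
    refine Finset.sum_congr rfl fun j _ => ?_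
    rw [map_smul, mul_smul_comm, smul_mul_assoc, Matrix.smul_apply, smul_eq_mul, mul_comm]
  have hP0 : ∀ a j, 0 ≤ P a j := by
    intro a j
    have := (Matrix.nonneg_iff_posSemidef.1 (hpos _ (hEpos j))).mul_mul_conjTranspose_same T⁻¹
    rw [Matrix.conjTranspose_eq_transpose_of_trivial, Matrix.transpose_nonsing_inv] at this
    exact this.diag_nonneg
  have hrow : ∀ a, ∑ j, P a j = 1 := by
    intro a
    have := hlin (fun _ => 1) a
    simp only [mul_one, Matrix.diagonal_one, ← h1] at this
    rw [this]
    have e := hconj 1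
    rw [mul_one, ← h3] at e
    rw [e, Matrix.one_apply_eq]
  have hwz : ∀ a, w a = ∑ j, P a j * z j := by
    intro a
    rw [hlin, ← h2]
    conv_rhs => rw [h4]
    rw [hconj, Matrix.diagonal_apply_eq]
  have hcol : ∀ j, ∑ a, P a j = Fintype.card ι / Fintype.card κ := by
    intro j
    have hY₀T : Y₀ = Tᵀ⁻¹ * T⁻¹ := by
      rw [← Matrix.nonsing_inv_nonsing_inv Y₀ hY₀.det_pos.ne'.isUnit, ← hΦ, h3,
        Matrix.mul_inv_rev]
    have symY : Y₀ᵀ = Y₀ := by simpa using hY₀.1.eq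
    have symX : (X₀⁻¹)ᵀ = X₀⁻¹ := by simpa using hX₀.inv.1.eq
    have e1 : ∑ a, P a j = (Y₀ * Φ (E j)).trace := by
      rw [hY₀T, mul_assoc, Matrix.trace_mul_comm]
      rfl
    have e2 := htip Y₀ (E j)
    have e3 : (X₀⁻¹ * E j).trace = 1 := by
      rw [h1, Matrix.mul_inv_rev, hE]
      have : Sᵀ⁻¹ * S⁻¹ * (S * Matrix.diagonal (Pi.single j 1) * Sᵀ) =
          Sᵀ⁻¹ * ((S⁻¹ * S) * Matrix.diagonal (Pi.single j 1) * Sᵀ) := by simp only [mul_assoc]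
      dsimp only
      rw [this, Matrix.nonsing_inv_mul _ hS, one_mul, Matrix.trace_mul_comm, mul_assoc,
        Matrix.mul_nonsing_inv _ hS', mul_one, Matrix.trace_diagonal]
      simp
    rw [hΨ, tip, tip, symY, symX, e3, ← e1] at e2
    field_simp at e2 ⊢
    linarith
  have hjensen : ∀ a, ∑ j, P a j * Real.log (z j) ≤ Real.log (w a) := by
    intro a
    rw [hwz]
    exact strictConcaveOn_log_Ioi.concaveOn.le_map_sum (fun j _ => hP0 a j) (hrow a)
      fun j _ => hz j
  have hfin : Fintype.card ι / Fintype.card κ * ∑ j, Real.log (z j) ≤ ∑ a, Real.log (w a) := by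
    refine le_trans (le_of_eq ?_) (Finset.sum_le_sum fun a _ => hjensen a)
    rw [Finset.sum_comm, Finset.mul_sum]
    refine Finset.sum_congr rfl fun j _ => ?_
    rw [← Finset.sum_mul, hcol]
  have l1 : Real.log X.det = ∑ j, Real.log (z j) + Real.log X₀.det := by
    conv_lhs => rw [h2]
    rw [log_det_conj_diagonal hS hz, ← h1]
  have l2 : Real.log (Φ X).det = ∑ a, Real.log (w a) - Real.log Y₀.det := by
    conv_lhs => rw [h4]
    rw [log_det_conj_diagonal hT hw, ← h3, hΦ, Matrix.det_nonsing_inv, Ring.inverse_eq_inv,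
      Real.log_inv, sub_eq_add_neg]
  rw [l1, l2]
  have : (∑ j, Real.log (z j)) / Fintype.card κ ≤ (∑ a, Real.log (w a)) / Fintype.card ι := by
    rw [le_div_iff₀ cι]
    refine le_trans (le_of_eq ?_) hfin
    ring
  rw [add_div, sub_div]
  linarith

end FixedPointCapacity

/-! ### The second singular value as a bound on a hyperplane. -/

section SingularValues

theorem exists_forall_inner_eq_zero_norm_le {E F : Type*} [NormedAddCommGroup E]
    [InnerProductSpace ℝ E] [FiniteDimensional ℝ E] [NormedAddCommGroup F]
    [InnerProductSpace ℝ F] [FiniteDimensional ℝ F] (T : E →ₗ[ℝ] F) :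
    ∃ v : E, ∀ w, inner ℝ v w = 0 → ‖T w‖ ≤ T.singularValues 1 * ‖w‖ := by
  rcases Nat.eq_zero_or_pos (Module.finrank ℝ E) with h0 | hpos
  · refine ⟨0, fun w _ => ?_⟩
    have : Subsingleton E := Module.finrank_zero_iff.1 h0
    simp [Subsingleton.elim w 0]
  set hS := T.isSymmetric_adjoint_comp_self
  set b := hS.eigenvectorBasis rfl with hb
  -- The witness is a top right singular vector: an eigenvector of `T* T` for its largest
  -- eigenvalue. Indices from `1` on carry singular values at most `T.singularValues 1`.
  refine ⟨b ⟨0, hpos⟩, fun w hw => ?_⟩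
  refine abs_le_of_sq_le_sq' ?_ (mul_nonneg (T.singularValues_nonneg 1) (norm_nonneg w)) |>.2
  have e1 : ‖T w‖ ^ 2 = ∑ i : Fin (Module.finrank ℝ E), T.singularValues i ^ 2 * inner ℝ (b i) w ^ 2 := by
    rw [← real_inner_self_eq_norm_sq, ← LinearMap.adjoint_inner_right, ← LinearMap.comp_apply,
      ← b.sum_inner_mul_inner]
    refine Finset.sum_congr rfl fun i _ => ?_
    rw [T.sq_singularValues_fin rfl, ← hS (b i) w, hS.apply_eigenvectorBasis rfl i]
    rw [real_inner_smul_left, real_inner_comm w]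
    simp
    ring
  have e2 : ‖w‖ ^ 2 = ∑ i, inner ℝ (b i) w ^ 2 := by
    rw [← b.sum_sq_norm_inner_right w]
    simp
  rw [mul_pow, e1, e2, Finset.mul_sum]
  refine Finset.sum_le_sum fun i _ => ?_
  by_cases hi : i = ⟨0, hpos⟩
  · rw [hi, hw]
    simp
  · refine mul_le_mul_of_nonneg_right ?_ (sq_nonneg _)
    refine pow_le_pow_left₀ (T.singularValues_nonneg _) (T.singularValues_antitone ?_) 2
    have : (i : ℕ) ≠ 0 := fun h => hi (Fin.ext h)
    omega

end SingularValues

/-! ### From operators to balanced pairs, and from fixed points to capacity. -/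

section Operators

variable {k m n : ℕ}

/-- The completely positive map as a linear map. -/
def cpMapLinear (A : Operator k m n) :
    Matrix (Fin n) (Fin n) ℝ →ₗ[ℝ] Matrix (Fin m) (Fin m) ℝ where
  toFun := cpMap A
  map_add' X Y := by simp [cpMap, Matrix.mul_add, Matrix.add_mul, Finset.sum_add_distrib]
  map_smul' c X := by simp [cpMap, Finset.smul_sum]

theorem cpMap_transpose (A : Operator k m n) :
    cpMap (fun i => (A i)ᵀ) = cpMapAdjoint A := by
  funext X
  simp [cpMap, cpMapAdjoint]

theorem cpMap_nonneg (A : Operator k m n) {X : Matrix (Fin n) (Fin n) ℝ} (hX : 0 ≤ X) :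
    0 ≤ cpMap A X := by
  rw [Matrix.nonneg_iff_posSemidef] at hX ⊢
  unfold cpMap
  refine Matrix.posSemidef_sum _ fun i _ => ?_
  have := hX.mul_mul_conjTranspose_same (A i)
  rwa [Matrix.conjTranspose_eq_transpose_of_trivial] at this

theorem trace_transpose_mul_cpMap (A : Operator k m n) (Y : Matrix (Fin m) (Fin m) ℝ)
    (X : Matrix (Fin n) (Fin n) ℝ) :
    (Yᵀ * cpMap A X).trace = ((cpMapAdjoint A Y)ᵀ * X).trace := by
  simp only [cpMap, cpMapAdjoint, Finset.mul_sum, Matrix.trace_sum, Matrix.transpose_sum,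
    Finset.sum_mul]
  refine Finset.sum_congr rfl fun i _ => ?_
  rw [Matrix.transpose_mul, Matrix.transpose_mul, Matrix.transpose_transpose,
    ← Matrix.mul_assoc, Matrix.trace_mul_comm]
  simp only [Matrix.mul_assoc]

theorem size_nonneg (A : Operator k m n) : 0 ≤ size A :=
  Finset.sum_nonneg fun _ _ => Finset.sum_nonneg fun _ _ => Finset.sum_nonneg fun _ _ => sq_nonneg _

theorem trace_cpMap_one (A : Operator k m n) : (cpMap A 1).trace = size A := by
  simp only [cpMap, size, Matrix.trace_sum, Matrix.mul_one]
  refine Finset.sum_congr rfl fun i _ => ?_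
  simp [Matrix.trace, Matrix.mul_apply, sq]

theorem sum_trace_mul_sq_le {p q : Type*} [Fintype p] [Fintype q] (B : Fin k → Matrix p q ℝ)
    (C : Fin k → Matrix q p ℝ) :
    (∑ i, (B i * C i).trace) ^ 2 ≤
      (∑ i, (B i * (B i)ᵀ).trace) * ∑ i, ((C i)ᵀ * C i).trace := by
  have h := Finset.sum_mul_sq_le_sq_mul_sq Finset.univ
    (fun x : Fin k × p × q => B x.1 x.2.1 x.2.2) (fun x => C x.1 x.2.2 x.2.1)
  simpa [Fintype.sum_prod_type, Matrix.trace, Matrix.mul_apply, sq] using h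

/-- Cauchy-Schwarz over the families `Yᵀ Aᵢ` and `X Aᵢᵀ`. After normalization it bounds the norms of
both maps by `1 + ε`. -/
theorem trace_mul_cpMap_sq_le (A : Operator k m n) {c d : ℝ} (hc : cpMap A 1 ≤ c • 1)
    (hd : cpMapAdjoint A 1 ≤ d • 1) (hc0 : 0 ≤ c) (Y : Matrix (Fin m) (Fin m) ℝ)
    (X : Matrix (Fin n) (Fin n) ℝ) :
    (Yᵀ * cpMap A X).trace ^ 2 ≤ (c * (Yᵀ * Y).trace) * (d * (Xᵀ * X).trace) := by
  have h1 := sum_trace_mul_sq_le (fun i => Yᵀ * A i) (fun i => X * (A i)ᵀ)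
  have e1 : ∑ i, (Yᵀ * A i * (X * (A i)ᵀ)).trace = (Yᵀ * cpMap A X).trace := by
    simp only [cpMap, Finset.mul_sum, Matrix.trace_sum, Matrix.mul_assoc]
  have e2 : ∑ i, (Yᵀ * A i * (Yᵀ * A i)ᵀ).trace = (Yᵀ * cpMap A 1 * Y).trace := by
    simp only [cpMap, Finset.mul_sum, Finset.sum_mul, Matrix.trace_sum, Matrix.mul_assoc,
      Matrix.one_mul, Matrix.transpose_mul, Matrix.transpose_transpose]
  have e3 : ∑ i, ((X * (A i)ᵀ)ᵀ * (X * (A i)ᵀ)).trace = (X * cpMapAdjoint A 1 * Xᵀ).trace := by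
    simp only [cpMapAdjoint, Finset.mul_sum, Finset.sum_mul, Matrix.trace_sum, Matrix.mul_one,
      Matrix.transpose_mul, Matrix.transpose_transpose]
    refine Finset.sum_congr rfl fun i _ => ?_
    rw [Matrix.trace_mul_comm, ← Matrix.mul_assoc, Matrix.mul_assoc X]
  rw [e1, e2, e3] at h1
  have i2 : (Yᵀ * cpMap A 1 * Y).trace ≤ c * (Yᵀ * Y).trace := by
    have := (Matrix.le_iff.1 hc).conjTranspose_mul_mul_same Y |>.trace_nonneg
    rw [Matrix.conjTranspose_eq_transpose_of_trivial, mul_sub, sub_mul, Matrix.trace_sub,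
      mul_smul_comm, smul_mul_assoc, mul_one, Matrix.trace_smul, smul_eq_mul] at this
    linarith
  have i3 : (X * cpMapAdjoint A 1 * Xᵀ).trace ≤ d * (Xᵀ * X).trace := by
    have := (Matrix.le_iff.1 hd).mul_mul_conjTranspose_same X |>.trace_nonneg
    rw [Matrix.conjTranspose_eq_transpose_of_trivial, mul_sub, sub_mul, Matrix.trace_sub,
      mul_smul_comm, smul_mul_assoc, mul_one, Matrix.trace_smul, smul_eq_mul,
      Matrix.trace_mul_comm X] at this
    linarith
  have n3 : 0 ≤ (X * cpMapAdjoint A 1 * Xᵀ).trace := by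
    rw [← e3]
    refine Finset.sum_nonneg fun i _ => ?_
    have := Matrix.posSemidef_conjTranspose_mul_self (X * (A i)ᵀ) |>.trace_nonneg
    rwa [Matrix.conjTranspose_eq_transpose_of_trivial] at this
  have n2 : 0 ≤ (Yᵀ * Y).trace := by
    have := Matrix.posSemidef_conjTranspose_mul_self Y |>.trace_nonneg
    rwa [Matrix.conjTranspose_eq_transpose_of_trivial] at this
  exact h1.trans (mul_le_mul i2 i3 n3 (mul_nonneg hc0 n2))

/-- The completely positive map, normalized to be nearly unital. -/
noncomputable def normalizedMap (A : Operator k m n) :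
    Matrix (Fin n) (Fin n) ℝ →ₗ[ℝ] Matrix (Fin m) (Fin m) ℝ :=
  (m / size A) • cpMapLinear A

/-- The adjoint of the completely positive map, normalized to be nearly unital. -/
noncomputable def normalizedMapAdjoint (A : Operator k m n) :
    Matrix (Fin m) (Fin m) ℝ →ₗ[ℝ] Matrix (Fin n) (Fin n) ℝ :=
  (n / size A) • cpMapLinear fun i => (A i)ᵀ

theorem normalizedMap_apply (A : Operator k m n) (X : Matrix (Fin n) (Fin n) ℝ) :
    normalizedMap A X = (m / size A) • cpMap A X := rfl

theorem normalizedMapAdjoint_apply (A : Operator k m n) (Y : Matrix (Fin m) (Fin m) ℝ) :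
    normalizedMapAdjoint A Y = (n / size A) • cpMapAdjoint A Y := by
  rw [← cpMap_transpose]
  rfl

theorem rms_le_of_tip_le {p q : Type*} [Fintype p] [Fintype q]
    {Φ : Matrix q q ℝ →ₗ[ℝ] Matrix p p ℝ} {c : ℝ} (hc : 0 ≤ c)
    (h : ∀ Y X, tip Y (Φ X) ≤ c * rms Y * rms X) (X : Matrix q q ℝ) :
    rms (Φ X) ≤ c * rms X := by
  have h1 := h (Φ X) X
  rw [← rms_sq] at h1
  rcases (rms_nonneg (Φ X)).eq_or_lt with h0 | h0
  · rw [← h0]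
    exact mul_nonneg hc (rms_nonneg X)
  · nlinarith

theorem isBalancedPair_normalizedMap (hm : 1 ≤ m) (hn : 1 ≤ n) {A : Operator k m n} {ε : ℝ}
    (hε : 0 ≤ ε) (hs : 0 < size A) (h : IsNearlyDoublyBalanced A ε) :
    IsBalancedPair (normalizedMap A) (normalizedMapAdjoint A) ε := by
  have cm : (0 : ℝ) < m := by exact_mod_cast hm
  have cn : (0 : ℝ) < n := by exact_mod_cast hn
  have htip : ∀ Y X, tip Y (normalizedMap A X) = tip (normalizedMapAdjoint A Y) X := by
    intro Y X
    rw [normalizedMap_apply, normalizedMapAdjoint_apply, tip_smul_left, tip_smul_right]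
    unfold tip
    rw [trace_transpose_mul_cpMap, Fintype.card_fin, Fintype.card_fin]
    field_simp
  have hbound : ∀ Y X, tip Y (normalizedMap A X) ≤ (1 + ε) * rms Y * rms X := by
    intro Y X
    have h1 := trace_mul_cpMap_sq_le A (Matrix.le_iff.2 h.left_upper)
      (Matrix.le_iff.2 h.right_upper) (by positivity) Y X
    refine abs_le_of_sq_le_sq' ?_ (by have := rms_nonneg Y; have := rms_nonneg X; positivity) |>.2
    rw [mul_pow, mul_pow, rms_sq, rms_sq, normalizedMap_apply, tip_smul_right, mul_pow]
    unfold tip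
    rw [Fintype.card_fin, Fintype.card_fin]
    have h2 := mul_le_mul_of_nonneg_left h1 (sq_nonneg ((size A)⁻¹))
    convert h2 using 1
    · field_simp
    · field_simp
  have key : ∀ {p c s : ℝ}, 0 < p → 0 < s → p / s * (c * (s / p)) = c := by
    intro p c s hp hs
    field_simp
  refine
    { map_nonneg := fun X hX => ?_
      map_nonneg' := fun Y hY => ?_
      tip_map := htip
      le_map_one := ?_
      map_one_le := ?_
      le_map_one' := ?_
      map_one_le' := ?_
      tip_one := ?_
      rms_map_le := rms_le_of_tip_le (by linarith) hbound
      rms_map_le' := rms_le_of_tip_le (by linarith) fun X Y => ?_ }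
  · rw [normalizedMap_apply]
    simpa using smul_le_smul_of_posSemidef (by positivity : 0 ≤ m / size A) (cpMap_nonneg A hX)
  · rw [normalizedMapAdjoint_apply, ← cpMap_transpose]
    simpa using smul_le_smul_of_posSemidef (by positivity : 0 ≤ n / size A)
      (cpMap_nonneg (fun i => (A i)ᵀ) hY)
  · have := smul_le_smul_of_posSemidef (by positivity : 0 ≤ m / size A)
      (Matrix.le_iff.2 h.left_lower)
    rwa [smul_smul, key cm hs] at this
  · have := smul_le_smul_of_posSemidef (by positivity : 0 ≤ m / size A)
      (Matrix.le_iff.2 h.left_upper)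
    rwa [smul_smul, key cm hs] at this
  · have := smul_le_smul_of_posSemidef (by positivity : 0 ≤ n / size A)
      (Matrix.le_iff.2 h.right_lower)
    rwa [smul_smul, key cn hs, ← normalizedMapAdjoint_apply] at this
  · have := smul_le_smul_of_posSemidef (by positivity : 0 ≤ n / size A)
      (Matrix.le_iff.2 h.right_upper)
    rwa [smul_smul, key cn hs, ← normalizedMapAdjoint_apply] at this
  · rw [tip_one_left, normalizedMap_apply, Matrix.trace_smul, trace_cpMap_one, Fintype.card_fin,
      smul_eq_mul]
    field_simp
  · rw [tip_comm, ← htip]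
    exact (hbound Y X).trans_eq (by ring)

theorem matrixRep_mulVec_vec (A : Operator k m n) (X : Matrix (Fin n) (Fin n) ℝ) :
    matrixRep A *ᵥ X.vec = (cpMap A X).vec := by
  simp only [matrixRep, cpMap, Matrix.sum_mulVec, Matrix.vec_sum, Matrix.kronecker_mulVec_vec]

theorem norm_toLp_vec (X : Matrix (Fin n) (Fin n) ℝ) :
    ‖WithLp.toLp 2 X.vec‖ = √n * rms X := by
  rcases Nat.eq_zero_or_pos n with rfl | hn
  · simp [EuclideanSpace.norm_eq]
  have cn : (0 : ℝ) < n := by exact_mod_cast hn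
  rw [EuclideanSpace.norm_eq, rms, ← Real.sqrt_mul cn.le, tip_eq_sum, Fintype.card_fin,
    mul_div_cancel₀ _ cn.ne', Fintype.sum_prod_type, Fintype.sum_prod_type_right]
  simp [Matrix.vec, sq]

theorem exists_rms_normalizedMap_le (hm : 1 ≤ m) (hn : 1 ≤ n) {A : Operator k m n} {lam : ℝ}
    (hs : 0 < size A) (h : HasSpectralGap A lam) :
    ∃ p : Matrix (Fin n) (Fin n) ℝ →ₗ[ℝ] ℝ,
      ∀ W, p W = 0 → rms (normalizedMap A W) ≤ (1 - lam) * rms W := by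
  have cm : (0 : ℝ) < m := by exact_mod_cast hm
  have cn : (0 : ℝ) < n := by exact_mod_cast hn
  obtain ⟨v, hv⟩ := exists_forall_inner_eq_zero_norm_le (Matrix.toEuclideanLin (matrixRep A))
  refine ⟨{ toFun := fun W => inner ℝ v (WithLp.toLp 2 W.vec)
            map_add' := fun X Y => by rw [Matrix.vec_add, WithLp.toLp_add, inner_add_right]
            map_smul' := fun c X => by
              rw [Matrix.vec_smul, WithLp.toLp_smul, real_inner_smul_right]; rfl }, ?_⟩
  intro W hW
  have h1 := hv _ hW
  have e1 : Matrix.toEuclideanLin (matrixRep A) (WithLp.toLp 2 W.vec) =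
      WithLp.toLp 2 (cpMap A W).vec := by
    rw [← matrixRep_mulVec_vec]
    rfl
  -- Vectorization turns `matrixRep A` into `cpMap A`; the factors `√m`, `√n` and `m / s` together
  -- cancel `s / √(mn)`.
  rw [e1, norm_toLp_vec, norm_toLp_vec] at h1
  have h2 : √(m : ℝ) * rms (cpMap A W) ≤ (1 - lam) * (size A / √((m : ℝ) * n)) * (√n * rms W) :=
    h1.trans (mul_le_mul_of_nonneg_right h
      (mul_nonneg (Real.sqrt_nonneg _) (rms_nonneg W)))
  have sm : 0 < √(m : ℝ) := Real.sqrt_pos.2 cm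
  have sn : 0 < √(n : ℝ) := Real.sqrt_pos.2 cn
  rw [normalizedMap_apply, rms_smul, abs_of_pos (by positivity)]
  rw [Real.sqrt_mul cm.le] at h2
  have h3 := mul_le_mul_of_nonneg_left h2 (by positivity : 0 ≤ √(m : ℝ) / size A)
  refine (le_of_eq ?_).trans (h3.trans (le_of_eq ?_))
  · rw [← mul_assoc, div_mul_eq_mul_div √(m : ℝ), Real.mul_self_sqrt cm.le]
  · field_simp

theorem capacity_le_size (hm : 1 ≤ m) (A : Operator k m n) : capacity A ≤ size A := by
  have cm : (0 : ℝ) < m := by exact_mod_cast hm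
  have : NeZero m := ⟨by omega⟩
  refine (ciInf_le (capacity_bddBelow A) ⟨1, Matrix.PosDef.one⟩).trans ?_
  have h1 : (cpMap A 1).PosSemidef := Matrix.nonneg_iff_posSemidef.1
    (cpMap_nonneg A (Matrix.nonneg_iff_posSemidef.2 Matrix.PosSemidef.one))
  have h2 := det_rpow_le_trace_div h1
  rw [trace_cpMap_one, Fintype.card_fin] at h2
  simp only [Matrix.det_one, Real.one_rpow, div_one]
  rw [le_div_iff₀ cm] at h2
  linarith

theorem capacity_nonneg (A : Operator k m n) : 0 ≤ capacity A := by
  refine Real.iInf_nonneg fun X => ?_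
  have h1 : (cpMap A X.1).PosSemidef := Matrix.nonneg_iff_posSemidef.1
    (cpMap_nonneg A (Matrix.nonneg_iff_posSemidef.2 X.2.posSemidef))
  have h2 := h1.det_nonneg
  have h3 := X.2.det_pos
  positivity

/-- Exponentiating the hypothesis gives the factor `exp(-ψ) ≥ 1 - ψ`; undoing the normalization
gives the factor `s`. -/
theorem le_capacity_of_log_det_le (hm : 1 ≤ m) (hn : 1 ≤ n) {A : Operator k m n}
    (hs : 0 < size A) {ψ : ℝ}
    (hpd : ∀ X : Matrix (Fin n) (Fin n) ℝ, X.PosDef → (normalizedMap A X).PosDef)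
    (h : ∀ X : Matrix (Fin n) (Fin n) ℝ, X.PosDef →
      Real.log X.det / n - ψ ≤ Real.log (normalizedMap A X).det / m) :
    (1 - ψ) * size A ≤ capacity A := by
  have cm : (0 : ℝ) < m := by exact_mod_cast hm
  have cn : (0 : ℝ) < n := by exact_mod_cast hn
  have : Nonempty {X : Matrix (Fin n) (Fin n) ℝ // X.PosDef} := ⟨⟨1, Matrix.PosDef.one⟩⟩
  refine le_ciInf fun ⟨X, hX⟩ => ?_
  dsimp only
  have hd := (hpd X hX).det_pos
  have hXd := hX.det_pos
  have e : cpMap A X = (size A / m) • normalizedMap A X := by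
    rw [normalizedMap_apply, smul_smul]
    field_simp
    rw [one_smul]
  have e2 : (m : ℝ) * (cpMap A X).det ^ (1 / (m : ℝ)) =
      size A * (normalizedMap A X).det ^ (1 / (m : ℝ)) := by
    rw [e, Matrix.det_smul, Fintype.card_fin, Real.mul_rpow (by positivity) hd.le, one_div,
      Real.pow_rpow_inv_natCast (by positivity) (by omega)]
    field_simp
  rw [e2, le_div_iff₀ (by positivity)]
  have h1 : X.det ^ (1 / (n : ℝ)) * Real.exp (-ψ) ≤ (normalizedMap A X).det ^ (1 / (m : ℝ)) := by
    rw [Real.rpow_def_of_pos hXd, Real.rpow_def_of_pos hd, ← Real.exp_add]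
    refine Real.exp_le_exp.2 ?_
    have := h X hX
    rw [mul_one_div, mul_one_div]
    linarith
  have h2 : 1 - ψ ≤ Real.exp (-ψ) := by linarith [Real.add_one_le_exp (-ψ)]
  have h3 : 0 ≤ X.det ^ (1 / (n : ℝ)) := by positivity
  calc (1 - ψ) * size A * X.det ^ (1 / (n : ℝ))
      = size A * (X.det ^ (1 / (n : ℝ)) * (1 - ψ)) := by ring
    _ ≤ size A * (X.det ^ (1 / (n : ℝ)) * Real.exp (-ψ)) := by gcongr
    _ ≤ _ := by gcongr

theorem le_capacity_of_fixed_point (hm : 1 ≤ m) (hn : 1 ≤ n) {A : Operator k m n}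
    (hs : 0 < size A) {ε : ℝ}
    (h : IsBalancedPair (normalizedMap A) (normalizedMapAdjoint A) ε)
    {X₀ : Matrix (Fin n) (Fin n) ℝ} {Y₀ : Matrix (Fin m) (Fin m) ℝ} (hX₀ : X₀.PosDef)
    (hY₀ : Y₀.PosDef) (hΦ : normalizedMap A X₀ = Y₀⁻¹) (hΨ : normalizedMapAdjoint A Y₀ = X₀⁻¹)
    {ψ : ℝ} (hψ : Real.log Y₀.det / m + Real.log X₀.det / n ≤ ψ) :
    (1 - ψ) * size A ≤ capacity A := by
  have : NeZero m := ⟨by omega⟩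
  have : NeZero n := ⟨by omega⟩
  refine le_capacity_of_log_det_le hm hn hs
    (fun X hX => posDef_map_of_posDef_map h.map_nonneg hX₀ hX (hΦ ▸ hY₀.inv)) fun X hX => ?_
  have := log_det_div_le_of_fixed_point h.map_nonneg h.tip_map hX₀ hY₀ hΦ hΨ hX
  rw [Fintype.card_fin, Fintype.card_fin] at this
  linarith

end Operators

/-! ### Choice of constants and the two cases of the theorem. -/

section Main

variable {k m n : ℕ}

theorem exists_iteration_count {m : ℕ} (hm : 2 ≤ m) {ε lam : ℝ} (hε : 0 ≤ ε) (hlam : 0 < lam)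
    (hlam1 : lam ≤ 1) (h : 10000 * ε * Real.log m ≤ lam ^ 2) :
    ε ≤ lam ^ 2 / 1200 ∧ ∃ K : ℕ, √(m : ℝ) * (1 - lam / 2) ^ K ≤ 1 ∧
      ((1 + ε) / (1 - ε)) ^ K ≤ 1 + lam / 200 := by
  have cm : (2 : ℝ) ≤ m := by exact_mod_cast hm
  have hlog : 1 / 2 ≤ Real.log m := by
    have := Real.log_two_gt_d9
    have := Real.log_le_log (by norm_num) cm
    linarith
  have hεl : ε ≤ lam ^ 2 / 5000 := by nlinarith
  have hε5 : ε ≤ 1 / 5000 := hεl.trans (by nlinarith)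
  -- This count makes `(1 - lam/2)^K ≤ m^(-1/2)`, while `ε K ≤ lam/2000` keeps `exp(3εK)` below `1 +
  -- lam/200`.
  refine ⟨by nlinarith, ⌈Real.log m / lam⌉₊, ?_, ?_⟩
  · have hK := Nat.le_ceil (Real.log m / lam)
    set K := ⌈Real.log m / lam⌉₊
    rw [div_le_iff₀ hlam] at hK
    have h1 : (1 - lam / 2) ^ K ≤ Real.exp (-(Real.log m / 2)) := by
      calc (1 - lam / 2) ^ K ≤ Real.exp (-(lam / 2)) ^ K :=
            pow_le_pow_left₀ (by linarith) (Real.one_sub_le_exp_neg _) K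
        _ = Real.exp (K * -(lam / 2)) := (Real.exp_nat_mul _ _).symm
        _ ≤ _ := Real.exp_le_exp.2 (by linarith)
    have h2 : √(m : ℝ) = Real.exp (Real.log m / 2) := by
      rw [← Real.log_sqrt (by positivity), Real.exp_log (by positivity)]
    calc √(m : ℝ) * (1 - lam / 2) ^ K ≤
          Real.exp (Real.log m / 2) * Real.exp (-(Real.log m / 2)) := by
            rw [h2]
            exact mul_le_mul_of_nonneg_left h1 (Real.exp_pos _).le
      _ = 1 := by rw [← Real.exp_add, add_neg_cancel, Real.exp_zero]
  · have hK := (Nat.ceil_lt_add_one (by positivity : 0 ≤ Real.log m / lam)).le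
    set K := ⌈Real.log m / lam⌉₊
    have hr : (1 + ε) / (1 - ε) ≤ Real.exp (3 * ε) := by
      refine le_trans ?_ (Real.add_one_le_exp _)
      rw [div_le_iff₀ (by linarith)]
      nlinarith
    have h1 : ε * K ≤ lam / 2000 := by
      have h2 : ε * K ≤ ε * (Real.log m / lam + 1) := mul_le_mul_of_nonneg_left hK hε
      have h3 : ε * (Real.log m / lam) ≤ lam / 10000 := by
        rw [mul_div_assoc', div_le_iff₀ hlam]
        nlinarith
      nlinarith
    calc ((1 + ε) / (1 - ε)) ^ K ≤ Real.exp (3 * ε) ^ K :=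
          pow_le_pow_left₀ (div_nonneg (by linarith) (by linarith)) hr K
      _ = Real.exp (K * (3 * ε)) := (Real.exp_nat_mul _ _).symm
      _ ≤ Real.exp (3 * lam / 2000) := Real.exp_le_exp.2 (by linarith)
      _ ≤ 1 + lam / 200 := by
          have h4 : |3 * lam / 2000| ≤ 1 := by
            rw [abs_of_nonneg (by positivity)]
            linarith
          have := (abs_le.1 (Real.abs_exp_sub_one_sub_id_le h4)).2
          nlinarith

theorem le_capacity_of_two_le (hm : 2 ≤ m) (hmn : m ≤ n) {A : Operator k m n} {ε lam : ℝ}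
    (hε : 0 ≤ ε) (hlam : 0 < lam) (hlam1 : lam ≤ 1) (hs : 0 < size A)
    (hA : IsNearlyDoublyBalanced A ε) (hgap : HasSpectralGap A lam)
    (h : 10000 * ε * Real.log m ≤ lam ^ 2) :
    (1 - 4 * ε ^ 2 / lam) * size A ≤ capacity A := by
  have : NeZero m := ⟨by omega⟩
  have : NeZero n := ⟨by omega⟩
  obtain ⟨hεl, K, hK, hr⟩ := exists_iteration_count hm hε hlam hlam1 h
  have hP := isBalancedPair_normalizedMap (by omega) (by omega) hε hs hA
  obtain ⟨p, hp⟩ := exists_rms_normalizedMap_le (by omega) (by omega) hs hgap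
  obtain ⟨Y, l, u, hY⟩ := hP.exists_fixed_point hlam hlam1 hε hεl hp
    (by rwa [Fintype.card_fin]) hr
  have hεl' : ε ≤ lam / 1000 := by nlinarith
  have hψ := hP.log_det_add_log_det_le hlam hlam1 hε hεl' hp l u hY
  rw [Fintype.card_fin, Fintype.card_fin] at hψ
  have hΨ := hP.symm.posDef_map (by linarith) (by linarith) l
  have hYd := posDef_of_smul_one_le (by linarith) l
  have hΦu : IsUnit (normalizedMap A (normalizedMapAdjoint A Y)⁻¹).det := by
    rw [← Matrix.isUnit_nonsing_inv_det_iff, hY]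
    exact hYd.det_pos.ne'.isUnit
  refine le_capacity_of_fixed_point (by omega) (by omega) hs hP hΨ.inv hYd ?_ ?_ (hψ.trans ?_)
  · conv_rhs => rw [← hY]
    rw [Matrix.nonsing_inv_nonsing_inv _ hΦu]
  · rw [Matrix.nonsing_inv_nonsing_inv _ hΨ.det_pos.ne'.isUnit]
  · gcongr
    norm_num

theorem le_capacity_of_one (hn : 1 ≤ n) {A : Operator k 1 n} {ε lam : ℝ}
    (hε : 0 ≤ ε) (hlam : 0 < lam) (hlam1 : lam ≤ 1) (hs : 0 < size A)
    (hA : IsNearlyDoublyBalanced A ε) :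
    (1 - 4 * ε ^ 2 / lam) * size A ≤ capacity A := by
  have : NeZero n := ⟨by omega⟩
  -- For `ε ≥ 1/2` and `lam ≤ 1` the claimed lower bound is nonpositive.
  rcases le_or_gt (1 / 2) ε with h | h
  · refine le_trans (mul_nonpos_of_nonpos_of_nonneg ?_ hs.le) (capacity_nonneg A)
    rw [sub_nonpos, one_le_div hlam]
    nlinarith
  have hP := isBalancedPair_normalizedMap le_rfl hn hε hs hA
  have hΨ : (normalizedMapAdjoint A 1).PosDef :=
    posDef_of_smul_one_le (by linarith) hP.le_map_one'
  have h11 : tip (1 : Matrix (Fin n) (Fin n) ℝ) 1 = 1 := by rw [← rms_sq, rms_one, one_pow]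
  -- The value is a `1 × 1` matrix, so adjointness, which fixes its trace, determines it: `Y = 1` is
  -- already a fixed point.
  have hfix : normalizedMap A (normalizedMapAdjoint A 1)⁻¹ = 1 := by
    have h1 := hP.tip_map 1 (normalizedMapAdjoint A 1)⁻¹
    have sym : (normalizedMapAdjoint A 1)ᵀ = normalizedMapAdjoint A 1 := by
      simpa using hΨ.1.eq
    rw [tip_one_left, tip, sym, Matrix.mul_nonsing_inv _ hΨ.det_pos.ne'.isUnit] at h1
    ext i j
    rw [Subsingleton.elim i 0, Subsingleton.elim j 0]
    simpa [Matrix.trace] using h1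
  refine le_capacity_of_fixed_point le_rfl hn hs hP hΨ.inv Matrix.PosDef.one
    (by rw [hfix, inv_one]) (by rw [Matrix.nonsing_inv_nonsing_inv _ hΨ.det_pos.ne'.isUnit]) ?_
  have h2 := le_log_det_div hP.le_map_one' hP.map_one_le' h.le
  have h3 := hP.symm.rms_map_one_sub_le hε
  have h4 : tip 1 (normalizedMapAdjoint A 1 - 1) = 0 := by
    rw [tip_sub_right, hP.symm.tip_one, h11, sub_self]
  have h5 := pow_le_pow_left₀ (rms_nonneg _) h3 2
  rw [rms_sq] at h5
  rw [h4, Fintype.card_fin] at h2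
  rw [Matrix.det_one, Real.log_one, zero_div, zero_add, Matrix.det_nonsing_inv,
    Ring.inverse_eq_inv, Real.log_inv, neg_div]
  have h6 : 4 * ε ^ 2 ≤ 4 * ε ^ 2 / lam := by
    rw [le_div_iff₀ hlam]
    nlinarith [sq_nonneg ε]
  nlinarith [sq_nonneg ε]

end Main
end OperatorScaling

theorem theoremt :
    ∃ C : ℝ, 0 < C ∧
      ∀ (k m n : ℕ), 1 ≤ m → m ≤ n →
        ∀ (A : OperatorScaling.Operator k m n) (ε lam : ℝ),
          0 ≤ ε → 0 < lam →
          OperatorScaling.IsNearlyDoublyBalanced A ε →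
          OperatorScaling.HasSpectralGap A lam →
          C * ε * Real.log m ≤ lam ^ 2 →
          OperatorScaling.capacity A ≤ OperatorScaling.size A ∧
          (1 - 4 * ε ^ 2 / lam) * OperatorScaling.size A ≤ OperatorScaling.capacity A := by
  refine ⟨10000, by norm_num, fun k m n hm hmn A ε lam hε hlam hA hgap h => ?_⟩
  refine ⟨OperatorScaling.capacity_le_size hm A, ?_⟩
  rcases (OperatorScaling.size_nonneg A).eq_or_lt with hs | hs
  · rw [← hs, mul_zero]
    exact OperatorScaling.capacity_nonneg A
  -- A singular value is nonnegative, so the gap condition with `s > 0` forces `1 - lam ≥ 0`.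
  have hlam1 : lam ≤ 1 := by
    have cm : (0 : ℝ) < m := by exact_mod_cast hm
    have cn : (0 : ℝ) < n := by exact_mod_cast hm.trans hmn
    have h1 := (LinearMap.singularValues_nonneg _ 1).trans hgap
    have h2 : 0 < OperatorScaling.size A / √((m : ℝ) * n) := by positivity
    linarith [nonneg_of_mul_nonneg_left h1 h2]
  rcases hm.eq_or_lt with rfl | hm2
  · exact OperatorScaling.le_capacity_of_one hmn hε hlam hlam1 hs hA
  · exact OperatorScaling.le_capacity_of_two_le hm2 hmn hε hlam hlam1 hs hA hgap h
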